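/- Let $(M,g)$ and $(N,h)$ be smooth Riemannian manifolds without boundary with $\dim M=\dim N-1$, with Levi-Civita connections $\nabla$ and $\nabla^h$, and let $\varphi:(M,g)\to(N,h)$ be a smooth isometric immersion ($\varphi^*h=g$). Let $\overline\nabla$ be the connection on $\varphi^{-1}TN$ induced by $\nabla^h$, let $B_\varphi(X,Y)=\overline\nabla_X(d\varphi(Y))-d\varphi(\nabla_XY)$, and let $\tau(\varphi)=\sum_i B_\varphi(e_i,e_i)$ be the tension field, where $\{e_i\}$ is a local orthonormal frame on $M$. With $R^h(U,V)W=\nabla^h_U\nabla^h_VW-\nabla^h_V\nabla^h_UW-\nabla^h_{[U,V]}W$, let $$\tau_2(\varphi)=-\sum_i\left(\overline\nabla_{e_i}\overline\nabla_{e_i}\tau(\varphi)-\overline\nabla_{\nabla_{e_i}e_i}\tau(\varphi)\right)-\sum_iR^h(\tau(\varphi),d\varphi(e_i))\,d\varphi(e_i)$$ be the bitension field. The map $\varphi$ is called harmonic if $\tau(\varphi)=0$ and biharmonic if $\tau_2(\varphi)=0$. Assume that 1. the Ricci curvature of $(N,h)$ is non-positive, i.e. $h\left(\sum_jR^h(u,e'_j)e'_j,\,u\right)\le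 0$ for all $y\in N$ and $u\in T_yN$, where $\{e'_j\}$ is an orthonormal basis of $T_yN$; 2. $\overline\nabla^{\perp}_X\tau(\varphi)=0$ for every $C^\infty$ vector field $X$ on $M$, where $\overline\nabla^{\perp}_X\tau(\varphi)$ is the component of $\overline\nabla_X\tau(\varphi)$ orthogonal to $d\varphi(TM)$. If $\varphi$ is biharmonic, then $\varphi$ is harmonic. -/

import Mathlib

open Bundle Manifold Module
open scoped ContDiff

noncomputable section

namespace RiemGeom

instance finiteDimensional_tangentSpace {E : Type*} [NormedAddCommGroup E] [NormedSpace ℝ E]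
    [FiniteDimensional ℝ E] {H : Type*} [TopologicalSpace H] (I : ModelWithCorners ℝ E H)
    {M : Type*} [TopologicalSpace M] [ChartedSpace H M] (x : M) :
    FiniteDimensional ℝ (TangentSpace I x) :=
  inferInstanceAs (FiniteDimensional ℝ E)

section Intrinsic

variable {E : Type*} [NormedAddCommGroup E] [NormedSpace ℝ E] [FiniteDimensional ℝ E]
  {H : Type*} [TopologicalSpace H] (I : ModelWithCorners ℝ E H)
  {M : Type*} [TopologicalSpace M] [ChartedSpace H M] [IsManifold I ∞ M]
  [RiemannianBundle (fun x : M ↦ TangentSpace I x)]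

/-- The right-hand side of the Koszul formula for `2 ⟨∇_X Y, Z⟩` at the point `x`:
`X⟨Y, Z⟩ + Y⟨X, Z⟩ - Z⟨X, Y⟩ + ⟨[X, Y], Z⟩ - ⟨[X, Z], Y⟩ - ⟨[Y, Z], X⟩`. -/
def koszul (X Y Z : Π x : M, TangentSpace I x) (x : M) : ℝ :=
  mvfderiv I (fun y ↦ inner ℝ (Y y) (Z y)) x (X x)
    + mvfderiv I (fun y ↦ inner ℝ (X y) (Z y)) x (Y x)
    - mvfderiv I (fun y ↦ inner ℝ (X y) (Y y)) x (Z x)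
    + inner ℝ (VectorField.mlieBracket I X Y x) (Z x)
    - inner ℝ (VectorField.mlieBracket I X Z x) (Y x)
    - inner ℝ (VectorField.mlieBracket I Y Z x) (X x)

/-- The Levi-Civita connection `∇_v Y` of a vector field `Y` in the direction of the tangent
vector `v` at `x`. It is the vector whose inner product with every `z` is half of the Koszul
expression, written out in an orthonormal basis of the tangent space; the expression does not
depend on how `v` and `z` are extended to vector fields near `x`. -/
def leviCivita (Y : Π x : M, TangentSpace I x) (x : M) (v : TangentSpace I x) :
    TangentSpace I x :=
  ∑ i, ((1 / 2 : ℝ) * koszul I (FiberBundle.extend E v) Y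
      (FiberBundle.extend E (stdOrthonormalBasis ℝ (TangentSpace I x) i)) x) •
    stdOrthonormalBasis ℝ (TangentSpace I x) i

/-- The curvature tensor `R(u, v) w = ∇_U ∇_V W - ∇_V ∇_U W - ∇_{[U, V]} W` at `x`, where `U`, `V`,
`W` are vector fields, smooth near `x`, with values `u`, `v`, `w` at `x`. -/
def curvature (x : M) (u v w : TangentSpace I x) : TangentSpace I x :=
  let U : Π y : M, TangentSpace I y := FiberBundle.extend E u
  let V : Π y : M, TangentSpace I y := FiberBundle.extend E v
  let W : Π y : M, TangentSpace I y := FiberBundle.extend E w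
  leviCivita I (fun y ↦ leviCivita I W y (V y)) x u
    - leviCivita I (fun y ↦ leviCivita I W y (U y)) x v
    - leviCivita I W x (VectorField.mlieBracket I U V x)

/-- The Ricci transform `ρ(u) = ∑ i, R(u, e_i) e_i`, for an orthonormal basis `e` of the tangent
space. -/
def ricciTransform (x : M) (u : TangentSpace I x) : TangentSpace I x :=
  ∑ i, curvature I x u (stdOrthonormalBasis ℝ (TangentSpace I x) i)
    (stdOrthonormalBasis ℝ (TangentSpace I x) i)

variable (M) in
/-- The Ricci curvature `Ric(u, u) = ⟨ρ(u), u⟩` is non-positive. -/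
def RicciNonpos : Prop :=
  ∀ (x : M) (u : TangentSpace I x), inner ℝ (ricciTransform I x u) u ≤ 0

end Intrinsic

section Maps

variable {E : Type*} [NormedAddCommGroup E] [NormedSpace ℝ E] [FiniteDimensional ℝ E]
  {H : Type*} [TopologicalSpace H] (I : ModelWithCorners ℝ E H)
  {M : Type*} [TopologicalSpace M] [ChartedSpace H M] [IsManifold I ∞ M]
  [RiemannianBundle (fun x : M ↦ TangentSpace I x)]
  {F : Type*} [NormedAddCommGroup F] [NormedSpace ℝ F] [FiniteDimensional ℝ F]
  {G : Type*} [TopologicalSpace G] (J : ModelWithCorners ℝ F G)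
  {N : Type*} [TopologicalSpace N] [ChartedSpace G N] [IsManifold J ∞ N]
  [RiemannianBundle (fun y : N ↦ TangentSpace J y)]

/-- `φ` is a smooth isometric immersion, `φ^* h = g`. The injectivity of the differential follows
from the preservation of the inner product. -/
structure IsIsometricImmersion (φ : M → N) : Prop where
  contMDiff : ContMDiff I J ∞ φ
  inner_mfderiv : ∀ (x : M) (v w : TangentSpace I x),
    inner ℝ (mfderiv I J φ x v) (mfderiv I J φ x w) = inner ℝ v w

/-- The connection on `φ⁻¹TN` induced by the Levi-Civita connection of `N`: the derivative at `x`
of the section `V` along `φ`, in the direction `v`. In the local frame `E_a` of `TN` given by the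
trivialization at `φ x`, where `V = ∑ a, V^a (E_a ∘ φ)`, it is
`∑ a, (d V^a (v) E_a + V^a(x) ∇_{dφ(v)} E_a)` at `φ x`; the field `∑ a, V^a(x) E_a` with constant
coefficients is `FiberBundle.extend F (V x)`. -/
def covAlong (φ : M → N) (V : Π x : M, TangentSpace J (φ x)) (x : M) (v : TangentSpace I x) :
    TangentSpace J (φ x) :=
  let e := trivializationAt F (fun y : N ↦ TangentSpace J y) (φ x)
  e.symm (φ x) (mvfderiv I (fun z : M ↦ (e ⟨φ z, V z⟩).2) x v)
    + leviCivita J (FiberBundle.extend F (V x)) (φ x) (mfderiv I J φ x v)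

/-- The second fundamental form `B(X, Y) = ∇̄_X (dφ(Y)) - dφ(∇_X Y)` of `φ` at `x`, with
`X = v` and `Y` a vector field, smooth near `x`, with value `w` at `x`. -/
def secondFundamentalForm (φ : M → N) (x : M) (v w : TangentSpace I x) : TangentSpace J (φ x) :=
  let Y : Π z : M, TangentSpace I z := FiberBundle.extend E w
  covAlong I J φ (fun z ↦ mfderiv I J φ z (Y z)) x v - mfderiv I J φ x (leviCivita I Y x v)

/-- The tension field `τ(φ) = ∑ i, B(e_i, e_i)`. -/
def tensionField (φ : M → N) (x : M) : TangentSpace J (φ x) :=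
  ∑ i, secondFundamentalForm I J φ x (stdOrthonormalBasis ℝ (TangentSpace I x) i)
    (stdOrthonormalBasis ℝ (TangentSpace I x) i)

/-- The Hessian `∇̄_v ∇̄_W V - ∇̄_{∇_v W} V` at `x` of a section `V` along `φ`, with `W` a vector
field, smooth near `x`, with value `w` at `x`; it is tensorial in `v` and `w`. -/
def hessianAlong (φ : M → N) (V : Π x : M, TangentSpace J (φ x)) (x : M)
    (v w : TangentSpace I x) : TangentSpace J (φ x) :=
  let W : Π z : M, TangentSpace I z := FiberBundle.extend E w
  covAlong I J φ (fun z ↦ covAlong I J φ V z (W z)) x v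
    - covAlong I J φ V x (leviCivita I W x v)

/-- The rough Laplacian `- ∑ i, (∇̄_{e_i} ∇̄_{e_i} V - ∇̄_{∇_{e_i} e_i} V)`. -/
def roughLaplacian (φ : M → N) (V : Π x : M, TangentSpace J (φ x)) (x : M) :
    TangentSpace J (φ x) :=
  - ∑ i, hessianAlong I J φ V x (stdOrthonormalBasis ℝ (TangentSpace I x) i)
    (stdOrthonormalBasis ℝ (TangentSpace I x) i)

/-- The operator `V ↦ ∑ i, R(V, dφ(e_i)) dφ(e_i)`. -/
def curvatureAlong (φ : M → N) (V : Π x : M, TangentSpace J (φ x)) (x : M) :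
    TangentSpace J (φ x) :=
  ∑ i, curvature J (φ x) (V x)
    (mfderiv I J φ x (stdOrthonormalBasis ℝ (TangentSpace I x) i))
    (mfderiv I J φ x (stdOrthonormalBasis ℝ (TangentSpace I x) i))

/-- The bitension field `τ₂(φ)`: the Jacobi operator applied to the tension field. -/
def bitensionField (φ : M → N) (x : M) : TangentSpace J (φ x) :=
  roughLaplacian I J φ (tensionField I J φ) x - curvatureAlong I J φ (tensionField I J φ) x

/-- A smooth map is harmonic if its tension field vanishes. -/
def IsHarmonic (φ : M → N) : Prop :=
  ContMDiff I J ∞ φ ∧ ∀ x : M, tensionField I J φ x = 0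

/-- A smooth map is biharmonic if its bitension field vanishes. -/
def IsBiharmonic (φ : M → N) : Prop :=
  ContMDiff I J ∞ φ ∧ ∀ x : M, bitensionField I J φ x = 0

/-- The normal component of the induced connection: the orthogonal projection of `∇̄_v V` to the
orthogonal complement of `dφ(T_x M)`. On normal sections it is the normal connection `∇̄^⊥`. -/
def normalCovAlong (φ : M → N) (V : Π x : M, TangentSpace J (φ x)) (x : M)
    (v : TangentSpace I x) : TangentSpace J (φ x) :=
  (LinearMap.range (mfderiv I J φ x).toLinearMap)ᗮ.starProjection (covAlong I J φ V x v)

/-- `∇̄^⊥_X V = 0` for all smooth vector fields `X` on `M`. -/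
def IsNormalParallel (φ : M → N) (V : Π x : M, TangentSpace J (φ x)) : Prop :=
  ∀ X : Π x : M, TangentSpace I x,
    ContMDiff I I.tangent ∞ (fun x ↦ (⟨x, X x⟩ : TangentBundle I M)) →
      ∀ x : M, normalCovAlong I J φ V x (X x) = 0

end Maps

end RiemGeom

end

namespace RiemGeom

open FiberBundle Filter Topology VectorField

set_option linter.unusedSectionVars false

theorem mvfderiv_congr {E : Type*} [NormedAddCommGroup E] [NormedSpace ℝ E]
    {H : Type*} [TopologicalSpace H] {I : ModelWithCorners ℝ E H}
    {M : Type*} [TopologicalSpace M] [ChartedSpace H M]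
    {F : Type*} [NormedAddCommGroup F] [NormedSpace ℝ F] {f g : M → F} {x : M}
    (h : f =ᶠ[𝓝 x] g) : mvfderiv I f x = mvfderiv I g x := by
  ext v
  simp only [mvfderiv, h.mfderiv_eq]
  rfl

section Koszul

variable {E : Type*} [NormedAddCommGroup E] [NormedSpace ℝ E] [FiniteDimensional ℝ E]
  {H : Type*} [TopologicalSpace H] {I : ModelWithCorners ℝ E H}
  {M : Type*} [TopologicalSpace M] [ChartedSpace H M] [IsManifold I ∞ M]
  [RiemannianBundle (fun x : M ↦ TangentSpace I x)]
  [IsContMDiffRiemannianBundle I ∞ E (fun x : M ↦ TangentSpace I x)]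
  {X X' Y Y' Z Z' : Π x : M, TangentSpace I x} {x : M} {f : M → ℝ}

theorem mdifferentiableAt_inner (hY : MDiffAt (T% Y) x) (hZ : MDiffAt (T% Z) x) :
    MDifferentiableAt I 𝓘(ℝ) (fun y ↦ (inner ℝ (Y y) (Z y) : ℝ)) x :=
  MDifferentiableAt.inner_bundle (F := E) (E := fun x : M ↦ TangentSpace I x) hY hZ

theorem mvfderiv_inner_add_left (hY : MDiffAt (T% Y) x) (hY' : MDiffAt (T% Y') x)
    (hZ : MDiffAt (T% Z) x) :
    mvfderiv I (fun y ↦ (inner ℝ ((Y + Y') y) (Z y) : ℝ)) x =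
      mvfderiv I (fun y ↦ (inner ℝ (Y y) (Z y) : ℝ)) x
        + mvfderiv I (fun y ↦ (inner ℝ (Y' y) (Z y) : ℝ)) x := by
  rw [← mvfderiv_fun_add (mdifferentiableAt_inner hY hZ) (mdifferentiableAt_inner hY' hZ)]
  congr 1
  ext y
  exact inner_add_left _ _ _

theorem mvfderiv_inner_comm (Y Z : Π x : M, TangentSpace I x) (x : M) :
    mvfderiv I (fun y ↦ (inner ℝ (Y y) (Z y) : ℝ)) x =
      mvfderiv I (fun y ↦ (inner ℝ (Z y) (Y y) : ℝ)) x := by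
  congr 1
  ext y
  exact real_inner_comm _ _

theorem mvfderiv_inner_smul_left (hf : MDiffAt f x) (hY : MDiffAt (T% Y) x)
    (hZ : MDiffAt (T% Z) x) (v : TangentSpace I x) :
    mvfderiv I (fun y ↦ (inner ℝ ((f • Y) y) (Z y) : ℝ)) x v =
      f x * mvfderiv I (fun y ↦ (inner ℝ (Y y) (Z y) : ℝ)) x v
        + mvfderiv I f x v * inner ℝ (Y x) (Z x) := by
  have : (fun y ↦ (inner ℝ ((f • Y) y) (Z y) : ℝ)) =
      fun y ↦ f y * (inner ℝ (Y y) (Z y) : ℝ) := by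
    ext y
    exact real_inner_smul_left _ _ _
  rw [this, mvfderiv_fun_mul hf (mdifferentiableAt_inner hY hZ)]
  simp [mul_comm]

theorem mvfderiv_inner_add_right (hY : MDiffAt (T% Y) x) (hZ : MDiffAt (T% Z) x)
    (hZ' : MDiffAt (T% Z') x) :
    mvfderiv I (fun y ↦ (inner ℝ (Y y) ((Z + Z') y) : ℝ)) x =
      mvfderiv I (fun y ↦ (inner ℝ (Y y) (Z y) : ℝ)) x
        + mvfderiv I (fun y ↦ (inner ℝ (Y y) (Z' y) : ℝ)) x := by
  rw [mvfderiv_inner_comm, mvfderiv_inner_add_left hZ hZ' hY, mvfderiv_inner_comm Y,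
    mvfderiv_inner_comm Y]

theorem mvfderiv_inner_smul_right (hf : MDiffAt f x) (hY : MDiffAt (T% Y) x)
    (hZ : MDiffAt (T% Z) x) (v : TangentSpace I x) :
    mvfderiv I (fun y ↦ (inner ℝ (Y y) ((f • Z) y) : ℝ)) x v =
      f x * mvfderiv I (fun y ↦ (inner ℝ (Y y) (Z y) : ℝ)) x v
        + mvfderiv I f x v * inner ℝ (Y x) (Z x) := by
  rw [mvfderiv_inner_comm, mvfderiv_inner_smul_left hf hZ hY, mvfderiv_inner_comm Y,
    real_inner_comm]

theorem koszul_add_left (hX : MDiffAt (T% X) x) (hX' : MDiffAt (T% X') x)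
    (hY : MDiffAt (T% Y) x) (hZ : MDiffAt (T% Z) x) :
    koszul I (X + X') Y Z x = koszul I X Y Z x + koszul I X' Y Z x := by
  simp only [koszul]
  rw [mvfderiv_inner_add_left hX hX' hY, mvfderiv_inner_add_left hX hX' hZ]
  simp only [mlieBracket_add_left hX hX', add_apply, Pi.add_apply, map_add,
    inner_add_left, inner_add_right]
  ring

theorem koszul_add_middle (hX : MDiffAt (T% X) x) (hY : MDiffAt (T% Y) x)
    (hY' : MDiffAt (T% Y') x) (hZ : MDiffAt (T% Z) x) :
    koszul I X (Y + Y') Z x = koszul I X Y Z x + koszul I X Y' Z x := by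
  simp only [koszul]
  rw [mvfderiv_inner_add_left hY hY' hZ, mvfderiv_inner_add_right hX hY hY']
  simp only [mlieBracket_add_left hY hY', mlieBracket_add_right hY hY', add_apply,
    Pi.add_apply, map_add, inner_add_left, inner_add_right]
  ring

theorem koszul_add_right (hX : MDiffAt (T% X) x) (hY : MDiffAt (T% Y) x)
    (hZ : MDiffAt (T% Z) x) (hZ' : MDiffAt (T% Z') x) :
    koszul I X Y (Z + Z') x = koszul I X Y Z x + koszul I X Y Z' x := by
  simp only [koszul]
  rw [mvfderiv_inner_add_right hY hZ hZ', mvfderiv_inner_add_right hX hZ hZ']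
  simp only [mlieBracket_add_right hZ hZ', add_apply,
    Pi.add_apply, map_add, inner_add_left, inner_add_right]
  ring

theorem koszul_smul_left (hf : MDiffAt f x) (hX : MDiffAt (T% X) x)
    (hY : MDiffAt (T% Y) x) (hZ : MDiffAt (T% Z) x) :
    koszul I (f • X) Y Z x = f x * koszul I X Y Z x := by
  simp only [koszul]
  rw [mvfderiv_inner_smul_left hf hX hY, mvfderiv_inner_smul_left hf hX hZ]
  simp only [mlieBracket_smul_left hf hX, Pi.smul_apply', map_smul, inner_add_left,
    real_inner_smul_left, real_inner_smul_right, smul_eq_mul]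
  rw [real_inner_comm (Y x) (X x)]
  ring

theorem koszul_smul_middle (hf : MDiffAt f x) (hX : MDiffAt (T% X) x)
    (hY : MDiffAt (T% Y) x) (hZ : MDiffAt (T% Z) x) :
    koszul I X (f • Y) Z x =
      f x * koszul I X Y Z x + 2 * (mvfderiv I f x (X x) * inner ℝ (Y x) (Z x)) := by
  simp only [koszul]
  rw [mvfderiv_inner_smul_left hf hY hZ, mvfderiv_inner_smul_right hf hX hY]
  simp only [mlieBracket_smul_left hf hY, mlieBracket_smul_right hf hY, Pi.smul_apply', map_smul,
    inner_add_left, real_inner_smul_left, real_inner_smul_right, smul_eq_mul]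
  rw [real_inner_comm (Y x) (X x)]
  ring

theorem koszul_smul_right (hf : MDiffAt f x) (hX : MDiffAt (T% X) x)
    (hY : MDiffAt (T% Y) x) (hZ : MDiffAt (T% Z) x) :
    koszul I X Y (f • Z) x = f x * koszul I X Y Z x := by
  simp only [koszul]
  rw [mvfderiv_inner_smul_right hf hY hZ, mvfderiv_inner_smul_right hf hX hZ]
  simp only [mlieBracket_smul_right hf hZ, Pi.smul_apply', map_smul, inner_add_left,
    real_inner_smul_left, real_inner_smul_right, smul_eq_mul]
  rw [real_inner_comm (Y x) (Z x), real_inner_comm (X x) (Z x)]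
  ring

theorem tensorialAt_koszul_left (hY : MDiffAt (T% Y) x) (hZ : MDiffAt (T% Z) x) :
    TensorialAt I E (fun X : Π x : M, TangentSpace I x ↦ koszul I X Y Z x) x where
  smul hf hX := koszul_smul_left hf hX hY hZ
  add hX hX' := koszul_add_left hX hX' hY hZ

theorem tensorialAt_koszul_right (hX : MDiffAt (T% X) x) (hY : MDiffAt (T% Y) x) :
    TensorialAt I E (fun Z : Π x : M, TangentSpace I x ↦ koszul I X Y Z x) x where
  smul hf hZ := koszul_smul_right hf hX hY hZ
  add hZ hZ' := koszul_add_right hX hY hZ hZ'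

end Koszul

section LeviCivita

variable {E : Type*} [NormedAddCommGroup E] [NormedSpace ℝ E] [FiniteDimensional ℝ E]
  {H : Type*} [TopologicalSpace H] {I : ModelWithCorners ℝ E H}
  {M : Type*} [TopologicalSpace M] [ChartedSpace H M] [IsManifold I ∞ M]
  [RiemannianBundle (fun x : M ↦ TangentSpace I x)]
  [IsContMDiffRiemannianBundle I ∞ E (fun x : M ↦ TangentSpace I x)]
  {X X' Y Y' Z Z' : Π x : M, TangentSpace I x} {x : M} {f : M → ℝ}

/-- The Koszul formula. -/
theorem inner_leviCivita (hX : MDiffAt (T% X) x) (hY : MDiffAt (T% Y) x)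
    (hZ : MDiffAt (T% Z) x) :
    inner ℝ (leviCivita I Y x (X x)) (Z x) = (1 / 2 : ℝ) * koszul I X Y Z x := by
  have hX' : MDiffAt (T% (extend E (X x))) x := mdifferentiableAt_extend ..
  have hXX : koszul I (extend E (X x)) Y Z x = koszul I X Y Z x :=
    (tensorialAt_koszul_left hY hZ).pointwise hX' hX (by simp)
  have hT := tensorialAt_koszul_right (I := I) hX' hY
  set b := stdOrthonormalBasis ℝ (TangentSpace I x)
  have key : ∑ i, inner ℝ (b i) (Z x) * koszul I (extend E (X x)) Y (extend E (b i)) x =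
      koszul I (extend E (X x)) Y Z x := by
    have h1 := hT.mkHom_apply hZ
    rw [← h1]
    conv_rhs => rw [← b.sum_repr' (Z x)]
    rw [map_sum]
    refine Finset.sum_congr rfl fun i _ ↦ ?_
    rw [map_smul, TensorialAt.mkHom_apply_eq_extend]
    rfl
  rw [← hXX, ← key, leviCivita, sum_inner, Finset.mul_sum]
  refine Finset.sum_congr rfl fun i _ ↦ ?_
  rw [real_inner_smul_left]
  ring

theorem inner_leviCivita_apply (hY : MDiffAt (T% Y) x) (v w : TangentSpace I x) :
    inner ℝ (leviCivita I Y x v) w =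
      (1 / 2 : ℝ) * koszul I (extend E v) Y (extend E w) x := by
  have := inner_leviCivita (X := extend E v) (Z := extend E w)
    (mdifferentiableAt_extend ..) hY (mdifferentiableAt_extend ..)
  simpa using this

theorem leviCivita_add_apply (hY : MDiffAt (T% Y) x) (v w : TangentSpace I x) :
    leviCivita I Y x (v + w) = leviCivita I Y x v + leviCivita I Y x w := by
  refine ext_inner_right ℝ fun u ↦ ?_
  have hT := tensorialAt_koszul_left (I := I) hY (mdifferentiableAt_extend I E u)
  rw [inner_add_left]
  simp only [inner_leviCivita_apply hY]
  simp only [← hT.mkHom_apply_eq_extend, map_add]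
  ring

theorem leviCivita_smul_apply (hY : MDiffAt (T% Y) x) (c : ℝ) (v : TangentSpace I x) :
    leviCivita I Y x (c • v) = c • leviCivita I Y x v := by
  refine ext_inner_right ℝ fun u ↦ ?_
  have hT := tensorialAt_koszul_left (I := I) hY (mdifferentiableAt_extend I E u)
  rw [real_inner_smul_left]
  simp only [inner_leviCivita_apply hY]
  simp only [← hT.mkHom_apply_eq_extend, map_smul, smul_eq_mul]
  ring

theorem leviCivita_add (hY : MDiffAt (T% Y) x) (hY' : MDiffAt (T% Y') x)
    (v : TangentSpace I x) :
    leviCivita I (Y + Y') x v = leviCivita I Y x v + leviCivita I Y' x v := by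
  refine ext_inner_right ℝ fun u ↦ ?_
  rw [inner_add_left, inner_leviCivita_apply (mdifferentiableAt_add_section hY hY'),
    inner_leviCivita_apply hY, inner_leviCivita_apply hY',
    koszul_add_middle (mdifferentiableAt_extend ..) hY hY' (mdifferentiableAt_extend ..)]
  ring

theorem leviCivita_smul (hf : MDiffAt f x) (hY : MDiffAt (T% Y) x) (v : TangentSpace I x) :
    leviCivita I (f • Y) x v = f x • leviCivita I Y x v + mvfderiv I f x v • Y x := by
  refine ext_inner_right ℝ fun u ↦ ?_
  rw [inner_add_left, inner_leviCivita_apply (hf.smul_section hY), real_inner_smul_left,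
    real_inner_smul_left, inner_leviCivita_apply hY,
    koszul_smul_middle hf (mdifferentiableAt_extend ..) hY (mdifferentiableAt_extend ..)]
  simp only [extend_apply_self]
  ring

theorem mvfderiv_inner (hY : MDiffAt (T% Y) x) (hZ : MDiffAt (T% Z) x)
    (v : TangentSpace I x) :
    mvfderiv I (fun y ↦ (inner ℝ (Y y) (Z y) : ℝ)) x v =
      inner ℝ (leviCivita I Y x v) (Z x) + inner ℝ (Y x) (leviCivita I Z x v) := by
  have hV : MDiffAt (T% (extend E v)) x := mdifferentiableAt_extend ..
  have h1 := inner_leviCivita (X := extend E v) hV hY hZ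
  have h2 := inner_leviCivita (X := extend E v) hV hZ hY
  rw [extend_apply_self] at h1 h2
  rw [real_inner_comm (leviCivita I Z x v), h1, h2]
  simp only [koszul, extend_apply_self, mlieBracket_swap_apply (V := Z) (W := Y), inner_neg_left,
    mvfderiv_inner_comm Z Y]
  ring

theorem leviCivita_sub_leviCivita (hX : MDiffAt (T% X) x) (hY : MDiffAt (T% Y) x) :
    leviCivita I Y x (X x) - leviCivita I X x (Y x) = mlieBracket I X Y x := by
  refine ext_inner_right ℝ fun u ↦ ?_
  have hU : MDiffAt (T% (extend E u)) x := mdifferentiableAt_extend ..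
  have h1 := inner_leviCivita hX hY hU
  have h2 := inner_leviCivita hY hX hU
  rw [extend_apply_self] at h1 h2
  rw [inner_sub_left, h1, h2]
  simp only [koszul, extend_apply_self, mlieBracket_swap_apply (V := Y) (W := X), inner_neg_left,
    mvfderiv_inner_comm Y X]
  ring

/-- `∇_v Y` only depends on the germ of `Y`. -/
theorem leviCivita_congr (h : Y =ᶠ[𝓝 x] Y') (v : TangentSpace I x) :
    leviCivita I Y x v = leviCivita I Y' x v := by
  have key (X Z : Π x : M, TangentSpace I x) : koszul I X Y Z x = koszul I X Y' Z x := by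
    have e1 : (fun y ↦ (inner ℝ (Y y) (Z y) : ℝ)) =ᶠ[𝓝 x] fun y ↦ inner ℝ (Y' y) (Z y) :=
      h.mono fun y hy ↦ by simp only [hy]
    have e2 : (fun y ↦ (inner ℝ (X y) (Y y) : ℝ)) =ᶠ[𝓝 x] fun y ↦ inner ℝ (X y) (Y' y) :=
      h.mono fun y hy ↦ by simp only [hy]
    simp only [koszul, mvfderiv_congr e1, mvfderiv_congr e2, h.self_of_nhds,
      EventuallyEq.mlieBracket_vectorField_eq (EventuallyEq.refl (𝓝 x) X) h,
      EventuallyEq.mlieBracket_vectorField_eq h (EventuallyEq.refl (𝓝 x) Z)]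
  simp only [leviCivita, key]

theorem leviCivita_zero_apply (hY : MDiffAt (T% Y) x) : leviCivita I Y x 0 = 0 := by
  simpa using leviCivita_smul_apply hY 0 0

end LeviCivita

section Smoothness

variable {E : Type*} [NormedAddCommGroup E] [NormedSpace ℝ E]
  {H : Type*} [TopologicalSpace H] {I : ModelWithCorners ℝ E H}
  {M : Type*} [TopologicalSpace M] [ChartedSpace H M] [IsManifold I ∞ M]
  {F : Type*} [NormedAddCommGroup F] [NormedSpace ℝ F]
  {G : Type*} [TopologicalSpace G] {J : ModelWithCorners ℝ F G}
  {N : Type*} [TopologicalSpace N] [ChartedSpace G N] [IsManifold J ∞ N]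

theorem contMDiffAt_mfderiv_apply {φ : M → N} {X : Π x : M, TangentSpace I x} {x : M}
    (hφ : ContMDiffAt I J ∞ φ x) (hX : ContMDiffAt I I.tangent ∞ (T% X) x) :
    ContMDiffAt I J.tangent ∞
      (fun z ↦ (⟨φ z, mfderiv I J φ z (X z)⟩ : TangentBundle J N)) x :=
  ContMDiffAt.clm_apply_of_inCoordinates (F₁ := E) (F₂ := F)
    (E₁ := (TangentSpace I : M → Type _)) (E₂ := (TangentSpace J : N → Type _))
    (b₁ := fun z : M ↦ z) (b₂ := φ) (ϕ := fun z ↦ mfderiv I J φ z)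
    (hφ.mfderiv_const (m := ∞) (n := ∞) le_rfl) hX hφ

theorem contMDiffAt_mvfderiv_apply {f : M → F} {X : Π x : M, TangentSpace I x} {x : M}
    (hf : ContMDiffAt I 𝓘(ℝ, F) ∞ f x) (hX : ContMDiffAt I I.tangent ∞ (T% X) x) :
    ContMDiffAt I 𝓘(ℝ, F) ∞ (fun z ↦ mvfderiv I f z (X z)) x := by
  have h := contMDiffAt_mfderiv_apply hf hX
  rw [contMDiffAt_totalSpace] at h
  refine h.2.congr_of_eventuallyEq (Eventually.of_forall fun z ↦ ?_)
  simp [trivializationAt_model_space_apply]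
  rfl

theorem eventually_mdifferentiableAt {f : M → N} {x : M} (hf : ContMDiffAt I J ∞ f x) :
    ∀ᶠ z in 𝓝 x, MDifferentiableAt I J f z :=
  ((contMDiffAt_iff_contMDiffAt_nhds (n := 1) (by simp)).1 (hf.of_le (by simp))).mono
    fun _ hz ↦ hz.mdifferentiableAt one_ne_zero

end Smoothness

section Musical

variable {E : Type*} [NormedAddCommGroup E] [NormedSpace ℝ E] [FiniteDimensional ℝ E]
  {H : Type*} [TopologicalSpace H] {I : ModelWithCorners ℝ E H}
  {M : Type*} [TopologicalSpace M] [ChartedSpace H M] [IsManifold I ∞ M]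
  [RiemannianBundle (fun x : M ↦ TangentSpace I x)]
  [IsContMDiffRiemannianBundle I ∞ E (fun x : M ↦ TangentSpace I x)]
  {X Y Z : Π x : M, TangentSpace I x} {x : M}

theorem contMDiffAt_inner (hY : ContMDiffAt I I.tangent ∞ (T% Y) x)
    (hZ : ContMDiffAt I I.tangent ∞ (T% Z) x) :
    ContMDiffAt I 𝓘(ℝ) ∞ (fun y ↦ (inner ℝ (Y y) (Z y) : ℝ)) x :=
  ContMDiffAt.inner_bundle (F := E) (E := fun x : M ↦ TangentSpace I x) hY hZ

theorem contMDiffAt_koszul (hX : ContMDiffAt I I.tangent ∞ (T% X) x)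
    (hY : ContMDiffAt I I.tangent ∞ (T% Y) x) (hZ : ContMDiffAt I I.tangent ∞ (T% Z) x) :
    ContMDiffAt I 𝓘(ℝ) ∞ (koszul I X Y Z) x := by
  have : IsManifold I ((⊤ : ℕ∞) + 1) M := inferInstanceAs (IsManifold I ∞ M)
  have : IsManifold I (minSmoothness ℝ 2) M := by
    rw [minSmoothness_of_isRCLikeNormedField]
    infer_instance
  have hb {U V : Π x : M, TangentSpace I x} (hU : ContMDiffAt I I.tangent ∞ (T% U) x)
      (hV : ContMDiffAt I I.tangent ∞ (T% V) x) :
      ContMDiffAt I I.tangent ∞ (T% (mlieBracket I U V)) x :=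
    ContMDiffAt.mlieBracket_vectorField (m := ⊤) (n := ⊤) hU hV (by simp)
  exact (((((contMDiffAt_mvfderiv_apply (contMDiffAt_inner hY hZ) hX).add
    (contMDiffAt_mvfderiv_apply (contMDiffAt_inner hX hZ) hY)).sub
    (contMDiffAt_mvfderiv_apply (contMDiffAt_inner hX hY) hZ)).add
    (contMDiffAt_inner (hb hX hY) hZ)).sub (contMDiffAt_inner (hb hX hZ) hY)).sub
    (contMDiffAt_inner (hb hY hZ) hX)

/-- A vector field is smooth as soon as its inner products with smooth vector fields are. -/
theorem contMDiffAt_of_inner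
    (h : ∀ Z : Π x : M, TangentSpace I x, ContMDiffAt I I.tangent ∞ (T% Z) x →
      ContMDiffAt I 𝓘(ℝ) ∞ (fun y ↦ (inner ℝ (Y y) (Z y) : ℝ)) x) :
    ContMDiffAt I I.tangent ∞ (T% Y) x := by
  set t := trivializationAt E (TangentSpace I : M → Type _) x
  have hx : x ∈ t.baseSet := mem_baseSet_trivializationAt E _ x
  let b := finBasis ℝ E
  let ι := Fin (finrank ℝ E)
  let s := t.localFrame b
  have hs (i) : ContMDiffAt I I.tangent ∞ (T% (s i)) x :=
    contMDiffAt_localFrame_of_mem ∞ t b i hx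
  let L : (ι → ι → ℝ) →ₗ[ℝ] ((ι → ℝ) →L[ℝ] (ι → ℝ)) :=
    LinearMap.toContinuousLinearMap.toLinearMap ∘ₗ (Matrix.toLin' (R := ℝ) (m := ι) (n := ι)).toLinearMap
  let A (z : M) := L fun i j ↦ (inner ℝ (s i z) (s j z) : ℝ)
  have hA : ContMDiffAt I 𝓘(ℝ, (ι → ℝ) →L[ℝ] (ι → ℝ)) ∞ A x := by
    have h1 : ContMDiffAt I 𝓘(ℝ, ι → ι → ℝ) ∞
        (fun z ↦ fun i j ↦ (inner ℝ (s i z) (s j z) : ℝ)) x :=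
      contMDiffAt_pi_space.2 fun i ↦ contMDiffAt_pi_space.2 fun j ↦ contMDiffAt_inner (hs i) (hs j)
    exact (L.toContinuousLinearMap.contDiff.contMDiff _).comp x h1
  have hAapp (z : M) (c : ι → ℝ) (i : ι) :
      A z c i = inner ℝ (s i z) (∑ j, c j • s j z) := by
    have h1 : A z c i = ∑ j, (inner ℝ (s i z) (s j z) : ℝ) * c j := rfl
    rw [h1, inner_sum]
    exact Finset.sum_congr rfl fun j _ ↦ by rw [real_inner_smul_right, mul_comm]
  have hAinj (z : M) (hz : z ∈ t.baseSet) : ∃ e : (ι → ℝ) ≃L[ℝ] (ι → ℝ), (e : _ →L[ℝ] _) = A z := by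
    have hinj : Function.Injective (A z).toLinearMap := by
      rw [← LinearMap.ker_eq_bot, LinearMap.ker_eq_bot']
      intro c hc
      have h0 : ∑ j, c j • s j z = 0 := by
        rw [← inner_self_eq_zero (𝕜 := ℝ)]
        conv_lhs => rw [sum_inner]
        refine Finset.sum_eq_zero fun i _ ↦ ?_
        rw [real_inner_smul_left, ← hAapp]
        have : A z c i = 0 := congrFun hc i
        rw [this, mul_zero]
      have hli := (t.isLocalFrameOn_localFrame_baseSet I 1 b).linearIndependent hz
      exact funext (Fintype.linearIndependent_iff.1 hli c h0)
    refine ⟨(LinearEquiv.ofInjectiveEndo _ hinj).toContinuousLinearEquiv, ?_⟩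
    ext c i
    rfl
  have hr : ContMDiffAt I 𝓘(ℝ, ι → ℝ) ∞ (fun z ↦ fun i ↦ (inner ℝ (Y z) (s i z) : ℝ)) x :=
    contMDiffAt_pi_space.2 fun i ↦ h _ (hs i)
  have hinv : ContMDiffAt I 𝓘(ℝ, (ι → ℝ) →L[ℝ] (ι → ℝ)) ∞ (fun z ↦ (A z).inverse) x := by
    obtain ⟨e, he⟩ := hAinj x hx
    have h1 : ContDiffAt ℝ ∞ ContinuousLinearMap.inverse (A x) := by
      rw [← he]
      exact contDiffAt_map_inverse e
    exact h1.contMDiffAt.comp x hA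
  have hc := hinv.clm_apply hr
  rw [contMDiffAt_pi_space] at hc
  rw [contMDiffAt_iff_localFrameCoeff b hx]
  intro i
  refine (hc i).congr_of_eventuallyEq ?_
  filter_upwards [t.open_baseSet.mem_nhds hx] with z hz
  obtain ⟨e, he⟩ := hAinj z hz
  have hAc : A z (fun j ↦ t.localFrameCoeff I b j z (Y z)) = fun i ↦ (inner ℝ (Y z) (s i z) : ℝ) := by
    ext i
    rw [hAapp, real_inner_comm, ← t.eq_sum_localFrameCoeff_smul hz]
  rw [← hAc, ← he, ContinuousLinearMap.inverse_equiv]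
  simp

theorem contMDiffAt_leviCivita (hX : ContMDiffAt I I.tangent ∞ (T% X) x)
    (hY : ContMDiffAt I I.tangent ∞ (T% Y) x) :
    ContMDiffAt I I.tangent ∞ (T% (fun z ↦ leviCivita I Y z (X z))) x := by
  refine contMDiffAt_of_inner fun Z hZ ↦ ?_
  have h1 : ContMDiffAt I 𝓘(ℝ) ∞ (fun z ↦ (1 / 2 : ℝ) * koszul I X Y Z z) x :=
    contMDiffAt_const.mul (contMDiffAt_koszul hX hY hZ)
  refine h1.congr_of_eventuallyEq ?_
  filter_upwards [eventually_mdifferentiableAt hX, eventually_mdifferentiableAt hY,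
    eventually_mdifferentiableAt hZ] with z h1 h2 h3
  exact inner_leviCivita h1 h2 h3

theorem mlieBracket_extend (v w : TangentSpace I x) :
    mlieBracket I (extend E v) (extend E w) x = 0 := by
  have key (u : TangentSpace I x) :
      mpullbackWithin 𝓘(ℝ, E) I (extChartAt I x).symm (extend E u) (Set.range I)
        =ᶠ[𝓝[Set.range I] (extChartAt I x x)]
      fun _ ↦ (trivializationAt E (TangentSpace I) x ⟨x, u⟩).2 := by
    filter_upwards [extChartAt_target_mem_nhdsWithin x] with y hy
    have hy' : (extChartAt I x).symm y ∈ (chartAt H x).source := by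
      rw [← extChartAt_source I]
      exact (extChartAt I x).map_target hy
    have hs := TangentBundle.symmL_trivializationAt (I := I) hy'
    rw [(extChartAt I x).right_inv hy] at hs
    rw [mpullbackWithin_apply, extend]
    have h2 : (trivializationAt E (TangentSpace I) x).symm ((extChartAt I x).symm y)
        (trivializationAt E (TangentSpace I) x ⟨x, u⟩).2 =
        mfderivWithin 𝓘(ℝ, E) I (extChartAt I x).symm (Set.range I) y
          (trivializationAt E (TangentSpace I) x ⟨x, u⟩).2 := by
      rw [← hs]
      exact ((trivializationAt E (TangentSpace I) x).symmL_apply (R := ℝ) hy' _).symm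
    rw [h2]
    have hi := isInvertible_mfderivWithin_extChartAt_symm hy
    exact congrArg (fun T ↦ T (trivializationAt E (TangentSpace I) x ⟨x, u⟩).2)
      hi.inverse_comp_self
  rw [← mlieBracketWithin_univ, mlieBracketWithin_apply]
  simp only [Set.preimage_univ, Set.univ_inter]
  have hmem : extChartAt I x x ∈ Set.range I := mem_extChartAt_target x |> extChartAt_target_subset_range x
  rw [(key v).lieBracketWithin_vectorField_eq_of_mem (key w) hmem]
  simp only [lieBracketWithin, fderivWithin_fun_const, Pi.zero_apply, zero_apply, sub_self]
  exact map_zero _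

end Musical

section Extend

variable {E : Type*} [NormedAddCommGroup E] [NormedSpace ℝ E] [FiniteDimensional ℝ E]
  {H : Type*} [TopologicalSpace H] {I : ModelWithCorners ℝ E H}
  {M : Type*} [TopologicalSpace M] [ChartedSpace H M] [IsManifold I ∞ M]
  [RiemannianBundle (fun x : M ↦ TangentSpace I x)]
  [IsContMDiffRiemannianBundle I ∞ E (fun x : M ↦ TangentSpace I x)]
  {x : M}

theorem eventually_trivializationAt_extend (v : TangentSpace I x) :
    ∀ᶠ z in 𝓝 x, (trivializationAt E (TangentSpace I) x ⟨z, extend E v z⟩).2 =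
      (trivializationAt E (TangentSpace I) x ⟨x, v⟩).2 := by
  filter_upwards [(trivializationAt E (TangentSpace I) x).open_baseSet.mem_nhds
    (mem_baseSet_trivializationAt E _ x)] with z hz
  simp only [extend]
  rw [Trivialization.apply_mk_symm _ hz]

theorem extend_congr_of_trivializationAt {Y : Π z : M, TangentSpace I z} {v : TangentSpace I x}
    (h : ∀ᶠ z in 𝓝 x, (trivializationAt E (TangentSpace I) x ⟨z, Y z⟩).2 =
      (trivializationAt E (TangentSpace I) x ⟨x, v⟩).2) :
    (extend E v : Π z : M, TangentSpace I z) =ᶠ[𝓝 x] Y := by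
  filter_upwards [h, (trivializationAt E (TangentSpace I) x).open_baseSet.mem_nhds
    (mem_baseSet_trivializationAt E _ x)] with z hz hz'
  simp only [extend, ← hz]
  exact Trivialization.symm_apply_apply_mk _ hz' _

theorem extend_add_eventuallyEq (v w : TangentSpace I x) :
    (extend E (v + w) : Π z : M, TangentSpace I z) =ᶠ[𝓝 x] extend E v + extend E w := by
  refine extend_congr_of_trivializationAt ?_
  filter_upwards [eventually_trivializationAt_extend v, eventually_trivializationAt_extend w,
    (trivializationAt E (TangentSpace I) x).open_baseSet.mem_nhds
      (mem_baseSet_trivializationAt E _ x)] with z h1 h2 hz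
  have l1 := ((trivializationAt E (TangentSpace I : M → Type _) x).linear ℝ hz).map_add
    (extend E v z) (extend E w z)
  have l2 := ((trivializationAt E (TangentSpace I : M → Type _) x).linear ℝ
    (mem_baseSet_trivializationAt E _ x)).map_add v w
  rw [Pi.add_apply, l1, h1, h2, l2]

theorem extend_smul_eventuallyEq (c : ℝ) (v : TangentSpace I x) :
    (extend E (c • v) : Π z : M, TangentSpace I z) =ᶠ[𝓝 x] (fun _ : M ↦ c) • extend E v := by
  refine extend_congr_of_trivializationAt ?_
  filter_upwards [eventually_trivializationAt_extend v,
    (trivializationAt E (TangentSpace I) x).open_baseSet.mem_nhds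
      (mem_baseSet_trivializationAt E _ x)] with z h1 hz
  have l1 := ((trivializationAt E (TangentSpace I : M → Type _) x).linear ℝ hz).map_smul
    c (extend E v z)
  have l2 := ((trivializationAt E (TangentSpace I : M → Type _) x).linear ℝ
    (mem_baseSet_trivializationAt E _ x)).map_smul c v
  rw [Pi.smul_apply', l1, h1, l2]

theorem leviCivita_extend_add (u v w : TangentSpace I x) :
    leviCivita I (extend E (v + w)) x u =
      leviCivita I (extend E v) x u + leviCivita I (extend E w) x u := by
  rw [leviCivita_congr (extend_add_eventuallyEq v w),
    leviCivita_add (mdifferentiableAt_extend ..) (mdifferentiableAt_extend ..)]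

theorem leviCivita_extend_smul (c : ℝ) (u v : TangentSpace I x) :
    leviCivita I (extend E (c • v)) x u = c • leviCivita I (extend E v) x u := by
  rw [leviCivita_congr (extend_smul_eventuallyEq c v),
    leviCivita_smul mdifferentiableAt_const (mdifferentiableAt_extend ..), mvfderiv_const]
  simp

end Extend

section Along

variable {E : Type*} [NormedAddCommGroup E] [NormedSpace ℝ E]
  {H : Type*} [TopologicalSpace H] {I : ModelWithCorners ℝ E H}
  {M : Type*} [TopologicalSpace M] [ChartedSpace H M] [IsManifold I ∞ M]
  {F : Type*} [NormedAddCommGroup F] [NormedSpace ℝ F] [FiniteDimensional ℝ F]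
  {G : Type*} [TopologicalSpace G] {J : ModelWithCorners ℝ F G}
  {N : Type*} [TopologicalSpace N] [ChartedSpace G N] [IsManifold J ∞ N]
  {φ : M → N} {V V' : Π z : M, TangentSpace J (φ z)} {x : M} {f : M → ℝ}

theorem eventually_mem_baseSet (hφ : ContinuousAt φ x) :
    ∀ᶠ z in 𝓝 x, φ z ∈ (trivializationAt F (TangentSpace J : N → Type _) (φ x)).baseSet :=
  hφ.preimage_mem_nhds <|
    (trivializationAt F (TangentSpace J : N → Type _) (φ x)).open_baseSet.mem_nhds
      (mem_baseSet_trivializationAt F _ (φ x))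

theorem trivializationAt_along_add (hφ : ContinuousAt φ x)
    (V V' : Π z : M, TangentSpace J (φ z)) :
    (fun z ↦ (trivializationAt F (TangentSpace J) (φ x) ⟨φ z, (V + V') z⟩).2) =ᶠ[𝓝 x]
      fun z ↦ (trivializationAt F (TangentSpace J) (φ x) ⟨φ z, V z⟩).2 +
        (trivializationAt F (TangentSpace J) (φ x) ⟨φ z, V' z⟩).2 :=
  (eventually_mem_baseSet hφ).mono fun z hz ↦
    ((trivializationAt F (TangentSpace J : N → Type _) (φ x)).linear ℝ hz).map_add (V z) (V' z)

theorem trivializationAt_along_smul (hφ : ContinuousAt φ x) (f : M → ℝ)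
    (V : Π z : M, TangentSpace J (φ z)) :
    (fun z ↦ (trivializationAt F (TangentSpace J) (φ x) ⟨φ z, (f • V) z⟩).2) =ᶠ[𝓝 x]
      fun z ↦ f z • (trivializationAt F (TangentSpace J) (φ x) ⟨φ z, V z⟩).2 :=
  (eventually_mem_baseSet hφ).mono fun z hz ↦
    ((trivializationAt F (TangentSpace J : N → Type _) (φ x)).linear ℝ hz).map_smul (f z) (V z)

theorem contMDiffAt_along_add
    (hV : ContMDiffAt I J.tangent ∞ (fun z ↦ (⟨φ z, V z⟩ : TangentBundle J N)) x)
    (hV' : ContMDiffAt I J.tangent ∞ (fun z ↦ (⟨φ z, V' z⟩ : TangentBundle J N)) x) :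
    ContMDiffAt I J.tangent ∞ (fun z ↦ (⟨φ z, (V + V') z⟩ : TangentBundle J N)) x := by
  rw [contMDiffAt_totalSpace] at *
  exact ⟨hV.1, (hV.2.add hV'.2).congr_of_eventuallyEq
    (trivializationAt_along_add hV.1.continuousAt V V')⟩

theorem contMDiffAt_along_smul (hf : ContMDiffAt I 𝓘(ℝ) ∞ f x)
    (hV : ContMDiffAt I J.tangent ∞ (fun z ↦ (⟨φ z, V z⟩ : TangentBundle J N)) x) :
    ContMDiffAt I J.tangent ∞ (fun z ↦ (⟨φ z, (f • V) z⟩ : TangentBundle J N)) x := by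
  rw [contMDiffAt_totalSpace] at *
  exact ⟨hV.1, (hf.smul hV.2).congr_of_eventuallyEq
    (trivializationAt_along_smul hV.1.continuousAt f V)⟩

theorem contMDiffAt_along_congr (h : V =ᶠ[𝓝 x] V')
    (hV : ContMDiffAt I J.tangent ∞ (fun z ↦ (⟨φ z, V z⟩ : TangentBundle J N)) x) :
    ContMDiffAt I J.tangent ∞ (fun z ↦ (⟨φ z, V' z⟩ : TangentBundle J N)) x :=
  hV.congr_of_eventuallyEq (h.mono fun z hz ↦ by simp only [hz])

theorem contMDiffAt_along_zero (hφ : ContMDiffAt I J ∞ φ x) :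
    ContMDiffAt I J.tangent ∞
      (fun z ↦ (⟨φ z, (0 : Π z : M, TangentSpace J (φ z)) z⟩ : TangentBundle J N)) x :=
  ContMDiffAt.comp x (g := fun y : N ↦ (⟨y, 0⟩ : TangentBundle J N))
    (contMDiffAt_zeroSection ℝ (TangentSpace J : N → Type _) (IB := J)) hφ

theorem contMDiffAt_along_sum {ι : Type*} (s : Finset ι)
    {V : ι → Π z : M, TangentSpace J (φ z)} (hφ : ContMDiffAt I J ∞ φ x)
    (hV : ∀ i ∈ s, ContMDiffAt I J.tangent ∞ (fun z ↦ (⟨φ z, V i z⟩ : TangentBundle J N)) x) :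
    ContMDiffAt I J.tangent ∞ (fun z ↦ (⟨φ z, (∑ i ∈ s, V i) z⟩ : TangentBundle J N)) x := by
  classical
  induction s using Finset.induction_on with
  | empty => exact contMDiffAt_along_zero hφ
  | insert a s ha ih =>
    simp only [Finset.mem_insert, forall_eq_or_imp] at hV
    rw [Finset.sum_insert ha]
    exact contMDiffAt_along_add hV.1 (ih hV.2)

/-- Smooth sections along `φ` are locally generated, over the smooth functions, by the sections
`s ∘ φ` for smooth vector fields `s` on the target. -/
theorem along_induction {P : (Π z : M, TangentSpace J (φ z)) → Prop}
    (congr : ∀ V V' : Π z : M, TangentSpace J (φ z), (∀ᶠ z in 𝓝 x, V z = V' z) → P V → P V')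
    (add : ∀ V V', ContMDiffAt I J.tangent ∞ (fun z ↦ (⟨φ z, V z⟩ : TangentBundle J N)) x →
      ContMDiffAt I J.tangent ∞ (fun z ↦ (⟨φ z, V' z⟩ : TangentBundle J N)) x →
      P V → P V' → P (V + V'))
    (smul : ∀ (f : M → ℝ) V, ContMDiffAt I 𝓘(ℝ) ∞ f x →
      ContMDiffAt I J.tangent ∞ (fun z ↦ (⟨φ z, V z⟩ : TangentBundle J N)) x → P V → P (f • V))
    (comp : ∀ s : Π y : N, TangentSpace J y, ContMDiffAt J J.tangent ∞ (T% s) (φ x) →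
      P fun z ↦ s (φ z))
    (hV : ContMDiffAt I J.tangent ∞ (fun z ↦ (⟨φ z, V z⟩ : TangentBundle J N)) x) : P V := by
  classical
  have h := contMDiffAt_totalSpace.1 hV
  set t := trivializationAt F (TangentSpace J : N → Type _) (φ x)
  have hx : φ x ∈ t.baseSet := mem_baseSet_trivializationAt F _ (φ x)
  let b := finBasis ℝ F
  let c (i) (z : M) : ℝ := b.coord i (t ⟨φ z, V z⟩).2
  have hφ : ContMDiffAt I J ∞ φ x := h.1
  have hc (i) : ContMDiffAt I 𝓘(ℝ) ∞ (c i) x :=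
    ((b.coord i).toContinuousLinearMap.contDiff.contMDiff _).comp x h.2
  have hs (i) : ContMDiffAt J J.tangent ∞ (T% (t.localFrame b i)) (φ x) :=
    contMDiffAt_localFrame_of_mem ∞ t b i hx
  have hsφ (i) : ContMDiffAt I J.tangent ∞
      (fun z ↦ (⟨φ z, t.localFrame b i (φ z)⟩ : TangentBundle J N)) x :=
    (hs i).comp x hφ
  have hsum (s : Finset (Fin (finrank ℝ F))) :
      P (∑ i ∈ s, c i • fun z ↦ t.localFrame b i (φ z)) := by
    induction s using Finset.induction_on with
    | empty =>
      have h0 : ContMDiffAt J J.tangent ∞ (fun y : N ↦ (⟨y, 0⟩ : TangentBundle J N)) (φ x) :=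
        contMDiffAt_zeroSection ℝ (TangentSpace J : N → Type _)
      rw [Finset.sum_empty]
      exact comp (fun _ ↦ 0) h0
    | insert a s ha ih =>
      rw [Finset.sum_insert ha]
      exact add _ _ (contMDiffAt_along_smul (hc a) (hsφ a))
        (contMDiffAt_along_sum s hφ fun i _ ↦ contMDiffAt_along_smul (hc i) (hsφ i))
        (smul _ _ (hc a) (hsφ a) (comp _ (hs a))) ih
  refine congr _ _ ?_ (hsum Finset.univ)
  filter_upwards [eventually_mem_baseSet (J := J) hφ.continuousAt] with z hz
  have := (t.basisAt b hz).sum_repr (V z)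
  conv_rhs => rw [← this]
  rw [Finset.sum_apply]
  refine Finset.sum_congr rfl fun i _ ↦ ?_
  rw [Pi.smul_apply', t.localFrame_apply_of_mem_baseSet b hz]
  congr 1

end Along

section CovAlong

variable {E : Type*} [NormedAddCommGroup E] [NormedSpace ℝ E]
  {H : Type*} [TopologicalSpace H] {I : ModelWithCorners ℝ E H}
  {M : Type*} [TopologicalSpace M] [ChartedSpace H M] [IsManifold I ∞ M]
  {F : Type*} [NormedAddCommGroup F] [NormedSpace ℝ F] [FiniteDimensional ℝ F]
  {G : Type*} [TopologicalSpace G] {J : ModelWithCorners ℝ F G}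
  {N : Type*} [TopologicalSpace N] [ChartedSpace G N] [IsManifold J ∞ N]
  [RiemannianBundle (fun y : N ↦ TangentSpace J y)]
  [IsContMDiffRiemannianBundle J ∞ F (fun y : N ↦ TangentSpace J y)]
  {φ : M → N} {V V' : Π z : M, TangentSpace J (φ z)} {x : M} {f : M → ℝ}

theorem trivializationAt_symm_add (y : N) (a b : F) :
    (trivializationAt F (TangentSpace J : N → Type _) y).symm y (a + b) =
      (trivializationAt F (TangentSpace J : N → Type _) y).symm y a +
      (trivializationAt F (TangentSpace J : N → Type _) y).symm y b := by
  have hy := mem_baseSet_trivializationAt F (TangentSpace J : N → Type _) y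
  simp only [← Trivialization.symmₗ_apply (R := ℝ) _ hy, map_add]

theorem trivializationAt_symm_smul (y : N) (c : ℝ) (a : F) :
    (trivializationAt F (TangentSpace J : N → Type _) y).symm y (c • a) =
      c • (trivializationAt F (TangentSpace J : N → Type _) y).symm y a := by
  have hy := mem_baseSet_trivializationAt F (TangentSpace J : N → Type _) y
  simp only [← Trivialization.symmₗ_apply (R := ℝ) _ hy, map_smul]

theorem covAlong_congr (h : V =ᶠ[𝓝 x] V') (v : TangentSpace I x) :
    covAlong I J φ V x v = covAlong I J φ V' x v := by
  have h1 : (fun z ↦ (trivializationAt F (TangentSpace J) (φ x) ⟨φ z, V z⟩).2) =ᶠ[𝓝 x]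
      fun z ↦ (trivializationAt F (TangentSpace J) (φ x) ⟨φ z, V' z⟩).2 :=
    h.mono fun z hz ↦ by simp only [hz]
  simp only [covAlong, mvfderiv_congr h1, h.self_of_nhds]

theorem covAlong_add
    (hV : MDifferentiableAt I J.tangent (fun z ↦ (⟨φ z, V z⟩ : TangentBundle J N)) x)
    (hV' : MDifferentiableAt I J.tangent (fun z ↦ (⟨φ z, V' z⟩ : TangentBundle J N)) x)
    (v : TangentSpace I x) :
    covAlong I J φ (V + V') x v = covAlong I J φ V x v + covAlong I J φ V' x v := by
  rw [mdifferentiableAt_totalSpace] at hV hV'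
  simp only [covAlong]
  rw [mvfderiv_congr (trivializationAt_along_add hV.1.continuousAt V V'),
    mvfderiv_fun_add hV.2 hV'.2, add_apply, trivializationAt_symm_add, Pi.add_apply,
    leviCivita_extend_add]
  abel

theorem covAlong_smul (hf : MDifferentiableAt I 𝓘(ℝ) f x)
    (hV : MDifferentiableAt I J.tangent (fun z ↦ (⟨φ z, V z⟩ : TangentBundle J N)) x)
    (v : TangentSpace I x) :
    covAlong I J φ (f • V) x v = f x • covAlong I J φ V x v + mvfderiv I f x v • V x := by
  rw [mdifferentiableAt_totalSpace] at hV
  simp only [covAlong]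
  rw [mvfderiv_congr (trivializationAt_along_smul hV.1.continuousAt f V),
    mvfderiv_fun_smul hf hV.2, add_apply, trivializationAt_symm_add, Pi.smul_apply',
    leviCivita_extend_smul, smul_apply, ContinuousLinearMap.smulRight_apply,
    trivializationAt_symm_smul, trivializationAt_symm_smul, smul_add,
    Trivialization.symm_apply_apply_mk _ (mem_baseSet_trivializationAt F _ (φ x))]
  abel

theorem covAlong_add_apply (V : Π z : M, TangentSpace J (φ z)) (v w : TangentSpace I x) :
    covAlong I J φ V x (v + w) = covAlong I J φ V x v + covAlong I J φ V x w := by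
  simp only [covAlong, map_add, trivializationAt_symm_add,
    leviCivita_add_apply (mdifferentiableAt_extend J F (V x))]
  abel

theorem covAlong_smul_apply (V : Π z : M, TangentSpace J (φ z)) (c : ℝ) (v : TangentSpace I x) :
    covAlong I J φ V x (c • v) = c • covAlong I J φ V x v := by
  simp only [covAlong, map_smul, trivializationAt_symm_smul, smul_add,
    leviCivita_smul_apply (mdifferentiableAt_extend J F (V x))]

theorem covAlong_comp {s : Π y : N, TangentSpace J y} (hφ : MDifferentiableAt I J φ x)
    (hs : MDiffAt (T% s) (φ x)) (v : TangentSpace I x) :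
    covAlong I J φ (fun z ↦ s (φ z)) x v = leviCivita J s (φ x) (mfderiv I J φ x v) := by
  have hcomp {σ : Π y : N, TangentSpace J y} (hσ : MDiffAt (T% σ) (φ x)) :
      MDifferentiableAt I J.tangent (fun z ↦ (⟨φ z, σ (φ z)⟩ : TangentBundle J N)) x :=
    MDifferentiableAt.comp x hσ hφ
  have hT : TensorialAt J F (fun s : Π y : N, TangentSpace J y ↦
      covAlong I J φ (fun z ↦ s (φ z)) x v - leviCivita J s (φ x) (mfderiv I J φ x v)) (φ x) := by
    constructor
    · intro f σ hf hσ
      have h1 := covAlong_smul (f := f ∘ φ) (hf.comp x hφ) (hcomp hσ) v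
      rw [mvfderiv_comp_apply x hf hφ] at h1
      rw [leviCivita_smul hf hσ]
      refine (congrArg (· - _) h1).trans ?_
      rw [add_sub_add_right_eq_sub, smul_sub]
      rfl
    · intro σ σ' hσ hσ'
      have h1 := covAlong_add (hcomp hσ) (hcomp hσ') v
      rw [leviCivita_add hσ hσ']
      refine (congrArg (· - _) h1).trans ?_
      abel
  have h := hT.pointwise hs (mdifferentiableAt_extend J F (s (φ x))) (by simp)
  rw [← sub_eq_zero, h, sub_eq_zero]
  have hc : (fun z ↦ (trivializationAt F (TangentSpace J) (φ x)
      ⟨φ z, extend F (s (φ x)) (φ z)⟩).2) =ᶠ[𝓝 x] fun _ ↦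
      (trivializationAt F (TangentSpace J) (φ x) ⟨φ x, s (φ x)⟩).2 :=
    hφ.continuousAt.eventually (eventually_trivializationAt_extend (s (φ x)))
  simp only [covAlong]
  rw [mvfderiv_congr hc, mvfderiv_const, extend_apply_self, zero_apply]
  have h0 := trivializationAt_symm_smul (J := J) (φ x) 0 (0 : F)
  rw [zero_smul, zero_smul] at h0
  rw [h0, zero_add]

/-- The induced connection is compatible with the metric. -/
theorem mvfderiv_inner_along
    (hV : ContMDiffAt I J.tangent ∞ (fun z ↦ (⟨φ z, V z⟩ : TangentBundle J N)) x)
    (hV' : ContMDiffAt I J.tangent ∞ (fun z ↦ (⟨φ z, V' z⟩ : TangentBundle J N)) x)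
    (v : TangentSpace I x) :
    mvfderiv I (fun z ↦ (inner ℝ (V z) (V' z) : ℝ)) x v =
      inner ℝ (covAlong I J φ V x v) (V' x) + inner ℝ (V x) (covAlong I J φ V' x v) := by
  have hφ : MDifferentiableAt I J φ x :=
    (contMDiffAt_totalSpace.1 hV).1.mdifferentiableAt (by simp)
  have hin {U W : Π z : M, TangentSpace J (φ z)}
      (hU : ContMDiffAt I J.tangent ∞ (fun z ↦ (⟨φ z, U z⟩ : TangentBundle J N)) x)
      (hW : ContMDiffAt I J.tangent ∞ (fun z ↦ (⟨φ z, W z⟩ : TangentBundle J N)) x) :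
      MDifferentiableAt I 𝓘(ℝ) (fun z ↦ (inner ℝ (U z) (W z) : ℝ)) x :=
    MDifferentiableAt.inner_bundle (F := F) (E := fun y : N ↦ TangentSpace J y) (b := φ)
      (hU.mdifferentiableAt (by simp)) (hW.mdifferentiableAt (by simp))
  let Q (U W : Π z : M, TangentSpace J (φ z)) : Prop :=
    mvfderiv I (fun z ↦ (inner ℝ (U z) (W z) : ℝ)) x v =
      inner ℝ (covAlong I J φ U x v) (W x) + inner ℝ (U x) (covAlong I J φ W x v)
  have hsymm {U W} (h : Q U W) : Q W U := by
    simp only [Q] at h ⊢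
    rw [real_inner_comm, add_comm, real_inner_comm (covAlong I J φ U x v), ← h]
    congr 2
    ext z
    exact real_inner_comm _ _
  have hind {W} (hW : ContMDiffAt I J.tangent ∞ (fun z ↦ (⟨φ z, W z⟩ : TangentBundle J N)) x)
      (hQ : ∀ s : Π y : N, TangentSpace J y, ContMDiffAt J J.tangent ∞ (T% s) (φ x) →
        Q (fun z ↦ s (φ z)) W) {U}
      (hU : ContMDiffAt I J.tangent ∞ (fun z ↦ (⟨φ z, U z⟩ : TangentBundle J N)) x) : Q U W := by
    refine along_induction (J := J) (φ := φ) (P := fun U ↦ Q U W) ?_ ?_ ?_ hQ hU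
    · intro U U' h hU
      simp only [Q] at hU ⊢
      have e : (fun z ↦ (inner ℝ (U' z) (W z) : ℝ)) =ᶠ[𝓝 x] fun z ↦ inner ℝ (U z) (W z) :=
        h.mono fun z hz ↦ by simp only [hz]
      rw [mvfderiv_congr e, hU, covAlong_congr h, h.self_of_nhds]
    · intro U U' sU sU' hU hU'
      simp only [Q] at hU hU' ⊢
      have e : (fun z ↦ (inner ℝ ((U + U') z) (W z) : ℝ)) =
          fun z ↦ (inner ℝ (U z) (W z) : ℝ) + inner ℝ (U' z) (W z) := by
        ext z
        exact inner_add_left _ _ _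
      rw [e, mvfderiv_fun_add (hin sU hW) (hin sU' hW), add_apply, hU, hU',
        covAlong_add (sU.mdifferentiableAt (by simp)) (sU'.mdifferentiableAt (by simp)),
        Pi.add_apply, inner_add_left, inner_add_left]
      ring
    · intro f U hf sU hU
      simp only [Q] at hU ⊢
      have e : (fun z ↦ (inner ℝ ((f • U) z) (W z) : ℝ)) =
          fun z ↦ f z * (inner ℝ (U z) (W z) : ℝ) := by
        ext z
        exact real_inner_smul_left _ _ _
      rw [e, mvfderiv_fun_mul (hf.mdifferentiableAt (by simp)) (hin sU hW), add_apply,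
        smul_apply, smul_apply, hU,
        covAlong_smul (hf.mdifferentiableAt (by simp)) (sU.mdifferentiableAt (by simp)),
        Pi.smul_apply', inner_add_left, real_inner_smul_left, real_inner_smul_left,
        real_inner_smul_left, smul_eq_mul, smul_eq_mul]
      ring
  have hcomp {s : Π y : N, TangentSpace J y} (hs : ContMDiffAt J J.tangent ∞ (T% s) (φ x)) :
      ContMDiffAt I J.tangent ∞ (fun z ↦ (⟨φ z, s (φ z)⟩ : TangentBundle J N)) x :=
    hs.comp x (contMDiffAt_totalSpace.1 hV).1
  refine hind hV' (fun s hs ↦ hsymm (hind (hcomp hs) (fun s' hs' ↦ ?_) hV')) hV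
  have ms := hs.mdifferentiableAt (by simp : (∞ : ℕ∞ω) ≠ 0)
  have ms' := hs'.mdifferentiableAt (by simp : (∞ : ℕ∞ω) ≠ 0)
  simp only [Q]
  rw [covAlong_comp hφ ms, covAlong_comp hφ ms', ← mvfderiv_inner ms' ms]
  exact mvfderiv_comp_apply x (mdifferentiableAt_inner ms' ms) hφ v

theorem contMDiffAt_covAlong {X : Π z : M, TangentSpace I z}
    (hV : ContMDiffAt I J.tangent ∞ (fun z ↦ (⟨φ z, V z⟩ : TangentBundle J N)) x)
    (hX : ContMDiffAt I I.tangent ∞ (T% X) x) :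
    ContMDiffAt I J.tangent ∞
      (fun z ↦ (⟨φ z, covAlong I J φ V z (X z)⟩ : TangentBundle J N)) x := by
  have hφ : ContMDiffAt I J ∞ φ x := (contMDiffAt_totalSpace.1 hV).1
  refine along_induction (J := J) (φ := φ) (P := fun V ↦ ContMDiffAt I J.tangent ∞
    (fun z ↦ (⟨φ z, covAlong I J φ V z (X z)⟩ : TangentBundle J N)) x) ?_ ?_ ?_ ?_ hV
  · intro U U' h hU
    refine contMDiffAt_along_congr ?_ hU
    filter_upwards [h.eventually_nhds] with z hz
    exact covAlong_congr hz _
  · intro U U' sU sU' hU hU'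
    refine contMDiffAt_along_congr ?_ (contMDiffAt_along_add hU hU')
    filter_upwards [eventually_mdifferentiableAt sU, eventually_mdifferentiableAt sU'] with z h h'
    exact (covAlong_add h h' _).symm
  · intro f U hf sU hU
    refine contMDiffAt_along_congr ?_ (contMDiffAt_along_add (contMDiffAt_along_smul hf hU)
      (contMDiffAt_along_smul (contMDiffAt_mvfderiv_apply hf hX) sU))
    filter_upwards [eventually_mdifferentiableAt sU, eventually_mdifferentiableAt hf] with z h h'
    exact (covAlong_smul h' h _).symm
  · intro s hs
    have h1 : ContMDiffAt I J.tangent ∞ (fun z ↦ (⟨φ z, leviCivita J s (φ z)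
        (mfderiv I J φ z (X z))⟩ : TangentBundle J N)) x := by
      have hs' := hφ.continuousAt.eventually (eventually_mdifferentiableAt hs)
      refine along_induction (J := J) (φ := φ) (P := fun U ↦ ContMDiffAt I J.tangent ∞
        (fun z ↦ (⟨φ z, leviCivita J s (φ z) (U z)⟩ : TangentBundle J N)) x) ?_ ?_ ?_ ?_
        (contMDiffAt_mfderiv_apply hφ hX)
      · intro U U' h hU
        exact contMDiffAt_along_congr (h.mono fun z hz ↦ congrArg (leviCivita J s (φ z)) hz) hU
      · intro U U' _ _ hU hU'
        refine contMDiffAt_along_congr ?_ (contMDiffAt_along_add hU hU')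
        filter_upwards [hs'] with z hz
        exact (leviCivita_add_apply hz _ _).symm
      · intro f U hf _ hU
        refine contMDiffAt_along_congr ?_ (contMDiffAt_along_smul hf hU)
        filter_upwards [hs'] with z hz
        exact (leviCivita_smul_apply hz _ _).symm
      · intro σ hσ
        exact (contMDiffAt_leviCivita hσ hs).comp x hφ
    refine contMDiffAt_along_congr ?_ h1
    filter_upwards [hφ.continuousAt.eventually (eventually_mdifferentiableAt hs),
      eventually_mdifferentiableAt hφ] with z hz hz'
    exact (covAlong_comp hz' hz _).symm

end CovAlong

section Torsion

variable {E : Type*} [NormedAddCommGroup E] [NormedSpace ℝ E] [FiniteDimensional ℝ E]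
  {H : Type*} [TopologicalSpace H] {I : ModelWithCorners ℝ E H} [I.Boundaryless]
  {M : Type*} [TopologicalSpace M] [ChartedSpace H M] [IsManifold I ∞ M]
  {F : Type*} [NormedAddCommGroup F] [NormedSpace ℝ F] [FiniteDimensional ℝ F]
  {G : Type*} [TopologicalSpace G] {J : ModelWithCorners ℝ F G}
  {N : Type*} [TopologicalSpace N] [ChartedSpace G N] [IsManifold J ∞ N]
  {φ : M → N} {x : M}

/-- The derivative of `φ` on the coordinate vector fields, read in the charts at `x` and `φ x`. -/
theorem trivializationAt_mfderiv_extend (hφ : ContMDiffAt I J ∞ φ x) (w : TangentSpace I x) :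
    (fun z ↦ (trivializationAt F (TangentSpace J) (φ x)
      ⟨φ z, mfderiv I J φ z (extend E w z)⟩).2) =ᶠ[𝓝 x]
      (fun u ↦ fderiv ℝ (writtenInExtChartAt I J x φ) u
        (trivializationAt E (TangentSpace I) x ⟨x, w⟩).2) ∘ extChartAt I x := by
  filter_upwards [eventually_mdifferentiableAt hφ, chart_source_mem_nhds H x,
    hφ.continuousAt.preimage_mem_nhds (chart_source_mem_nhds G (φ x))] with z hz hzs hzt
  have hzs' : z ∈ (extChartAt I x).source := by rwa [extChartAt_source]
  have hy : extChartAt I x z ∈ (extChartAt I x).target := (extChartAt I x).map_source hzs'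
  set w' := (trivializationAt E (TangentSpace I) x ⟨x, w⟩).2
  have h1 : extend E w z =
      mfderivWithin 𝓘(ℝ, E) I (extChartAt I x).symm (Set.range I) (extChartAt I x z) w' := by
    rw [← TangentBundle.symmL_trivializationAt hzs]
    exact ((trivializationAt E (TangentSpace I) x).symmL_apply (R := ℝ) hzs _).symm
  have h2 (u : TangentSpace J (φ z)) : (trivializationAt F (TangentSpace J) (φ x) ⟨φ z, u⟩).2 =
      mfderiv J 𝓘(ℝ, F) (extChartAt J (φ x)) (φ z) u := by
    rw [← TangentBundle.continuousLinearMapAt_trivializationAt hzt]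
    exact (Trivialization.continuousLinearMapAt_apply_of_mem ℝ _ hzt u).symm
  have hs : MDifferentiableWithinAt 𝓘(ℝ, E) I (extChartAt I x).symm (Set.range I)
      (extChartAt I x z) := mdifferentiableWithinAt_extChartAt_symm hy
  rw [I.range_eq_univ, mdifferentiableWithinAt_univ] at hs
  have hz' : MDifferentiableAt I J φ ((extChartAt I x).symm (extChartAt I x z)) := by
    rwa [(extChartAt I x).left_inv hzs']
  have hc : MDifferentiableAt J 𝓘(ℝ, F) (extChartAt J (φ x)) (φ z) := mdifferentiableAt_extChartAt hzt
  have hc' : MDifferentiableAt J 𝓘(ℝ, F) (extChartAt J (φ x))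
      (φ ((extChartAt I x).symm (extChartAt I x z))) := by
    rwa [(extChartAt I x).left_inv hzs']
  rw [h2, h1, I.range_eq_univ, mfderivWithin_univ]
  have h3 : mfderiv 𝓘(ℝ, E) 𝓘(ℝ, F) (writtenInExtChartAt I J x φ) (extChartAt I x z) w' =
      mfderiv J 𝓘(ℝ, F) (extChartAt J (φ x)) (φ ((extChartAt I x).symm (extChartAt I x z)))
        (mfderiv I J φ ((extChartAt I x).symm (extChartAt I x z))
          (mfderiv 𝓘(ℝ, E) I (extChartAt I x).symm (extChartAt I x z) w')) := by
    have e1 : writtenInExtChartAt I J x φ =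
        (extChartAt J (φ x)) ∘ (φ ∘ (extChartAt I x).symm) := rfl
    rw [e1, mfderiv_comp (extChartAt I x z) hc' (hz'.comp _ hs), mfderiv_comp (extChartAt I x z) hz' hs]
    rfl
  rw [mfderiv_eq_fderiv] at h3
  have h4 := (extChartAt I x).left_inv hzs'
  rw [Function.comp_apply]
  refine Eq.trans ?_ h3.symm
  rw [h4]

theorem mvfderiv_trivializationAt_mfderiv_extend_symm (hφ : ContMDiffAt I J ∞ φ x)
    (v w : TangentSpace I x) :
    mvfderiv I (fun z ↦ (trivializationAt F (TangentSpace J) (φ x)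
      ⟨φ z, mfderiv I J φ z (extend E w z)⟩).2) x v =
    mvfderiv I (fun z ↦ (trivializationAt F (TangentSpace J) (φ x)
      ⟨φ z, mfderiv I J φ z (extend E v z)⟩).2) x w := by
  set f := writtenInExtChartAt I J x φ
  have hf : ContDiffAt ℝ ∞ f (extChartAt I x x) := by
    have := (contMDiffAt_iff.1 hφ).2
    rwa [I.range_eq_univ, contDiffWithinAt_univ] at this
  have hd : DifferentiableAt ℝ (fderiv ℝ f) (extChartAt I x x) :=
    (hf.fderiv_right (m := ∞) le_rfl).differentiableAt (by simp)
  have hχ : MDifferentiableAt I 𝓘(ℝ, E) (extChartAt I x) x :=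
    mdifferentiableAt_extChartAt (mem_chart_source H x)
  have hkey (v w : TangentSpace I x) :
      mvfderiv I (fun z ↦ (trivializationAt F (TangentSpace J) (φ x)
        ⟨φ z, mfderiv I J φ z (extend E w z)⟩).2) x v =
      fderiv ℝ (fderiv ℝ f) (extChartAt I x x)
        (trivializationAt E (TangentSpace I) x ⟨x, v⟩).2
        (trivializationAt E (TangentSpace I) x ⟨x, w⟩).2 := by
    rw [mvfderiv_congr (trivializationAt_mfderiv_extend hφ w)]
    set w' := (trivializationAt E (TangentSpace I) x ⟨x, w⟩).2
    have h2 : (trivializationAt E (TangentSpace I) x ⟨x, v⟩).2 =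
        mfderiv I 𝓘(ℝ, E) (extChartAt I x) x v := by
      rw [← TangentBundle.continuousLinearMapAt_trivializationAt (mem_chart_source H x)]
      exact (Trivialization.continuousLinearMapAt_apply_of_mem ℝ _ (mem_chart_source H x) v).symm
    have hd' : DifferentiableAt ℝ (fun u ↦ fderiv ℝ f u w') (extChartAt I x x) :=
      hd.clm_apply (differentiableAt_const _)
    have h3 := mfderiv_comp_apply x hd'.mdifferentiableAt hχ v
    refine h3.trans ?_
    rw [h2, mfderiv_eq_fderiv, fderiv_clm_apply hd (differentiableAt_const _)]
    simp
    rfl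
  rw [hkey v w, hkey w v]
  exact (hf.isSymmSndFDerivAt (by simpa using ENat.LEInfty.out)) _ _

variable [RiemannianBundle (fun y : N ↦ TangentSpace J y)]
  [IsContMDiffRiemannianBundle J ∞ F (fun y : N ↦ TangentSpace J y)]

/-- The induced connection has no torsion, tested on coordinate vector fields. -/
theorem covAlong_mfderiv_extend_symm (hφ : ContMDiffAt I J ∞ φ x) (v w : TangentSpace I x) :
    covAlong I J φ (fun z ↦ mfderiv I J φ z (extend E w z)) x v =
      covAlong I J φ (fun z ↦ mfderiv I J φ z (extend E v z)) x w := by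
  simp only [covAlong, extend_apply_self]
  rw [mvfderiv_trivializationAt_mfderiv_extend_symm hφ v w]
  congr 1
  have h := leviCivita_sub_leviCivita
    (mdifferentiableAt_extend J F (mfderiv I J φ x v))
    (mdifferentiableAt_extend J F (mfderiv I J φ x w))
  rw [mlieBracket_extend, extend_apply_self, extend_apply_self, sub_eq_zero] at h
  exact h

end Torsion

section SecondFundamentalForm

variable {E : Type*} [NormedAddCommGroup E] [NormedSpace ℝ E] [FiniteDimensional ℝ E]
  {H : Type*} [TopologicalSpace H] {I : ModelWithCorners ℝ E H}
  {M : Type*} [TopologicalSpace M] [ChartedSpace H M] [IsManifold I ∞ M]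
  [RiemannianBundle (fun x : M ↦ TangentSpace I x)]
  [IsContMDiffRiemannianBundle I ∞ E (fun x : M ↦ TangentSpace I x)]
  {F : Type*} [NormedAddCommGroup F] [NormedSpace ℝ F] [FiniteDimensional ℝ F]
  {G : Type*} [TopologicalSpace G] {J : ModelWithCorners ℝ F G}
  {N : Type*} [TopologicalSpace N] [ChartedSpace G N] [IsManifold J ∞ N]
  [RiemannianBundle (fun y : N ↦ TangentSpace J y)]
  [IsContMDiffRiemannianBundle J ∞ F (fun y : N ↦ TangentSpace J y)]
  {φ : M → N} {x : M}

theorem mdifferentiableAt_mfderiv_apply {X : Π x : M, TangentSpace I x}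
    (hφ : ContMDiffAt I J ∞ φ x) (hX : MDiffAt (T% X) x) :
    MDifferentiableAt I J.tangent
      (fun z ↦ (⟨φ z, mfderiv I J φ z (X z)⟩ : TangentBundle J N)) x :=
  MDifferentiableAt.clm_apply_of_inCoordinates (F₁ := E) (F₂ := F)
    (E₁ := (TangentSpace I : M → Type _)) (E₂ := (TangentSpace J : N → Type _))
    (b₁ := fun z : M ↦ z) (b₂ := φ) (ϕ := fun z ↦ mfderiv I J φ z)
    ((hφ.mfderiv_const (m := ∞) (n := ∞) le_rfl).mdifferentiableAt (by simp)) hX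
    (hφ.mdifferentiableAt (by simp))

theorem tensorialAt_secondFundamentalForm (hφ : ContMDiffAt I J ∞ φ x) (v : TangentSpace I x) :
    TensorialAt I E (fun Y : Π z : M, TangentSpace I z ↦
      covAlong I J φ (fun z ↦ mfderiv I J φ z (Y z)) x v
        - mfderiv I J φ x (leviCivita I Y x v)) x where
  smul {f Y} hf hY := by
    have h : (fun z ↦ mfderiv I J φ z ((f • Y) z)) = f • fun z ↦ mfderiv I J φ z (Y z) := by
      ext z
      exact map_smul _ _ _
    rw [h, covAlong_smul hf (mdifferentiableAt_mfderiv_apply hφ hY), leviCivita_smul hf hY,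
      map_add, map_smul, map_smul, smul_sub]
    abel
  add {Y Y'} hY hY' := by
    have h : (fun z ↦ mfderiv I J φ z ((Y + Y') z)) =
        (fun z ↦ mfderiv I J φ z (Y z)) + fun z ↦ mfderiv I J φ z (Y' z) := by
      ext z
      exact map_add _ _ _
    rw [h, covAlong_add (mdifferentiableAt_mfderiv_apply hφ hY)
      (mdifferentiableAt_mfderiv_apply hφ hY'), leviCivita_add hY hY', map_add]
    abel

theorem secondFundamentalForm_apply (hφ : ContMDiffAt I J ∞ φ x) {Y : Π z : M, TangentSpace I z}
    (hY : MDiffAt (T% Y) x) (v : TangentSpace I x) :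
    secondFundamentalForm I J φ x v (Y x) =
      covAlong I J φ (fun z ↦ mfderiv I J φ z (Y z)) x v - mfderiv I J φ x (leviCivita I Y x v) :=
  (tensorialAt_secondFundamentalForm hφ v).pointwise (mdifferentiableAt_extend ..) hY (by simp)

/-- The second fundamental form as a bilinear map. -/
noncomputable def secondFundamentalFormHom (hφ : ContMDiffAt I J ∞ φ x) :
    TangentSpace I x →ₗ[ℝ] TangentSpace I x →ₗ[ℝ] TangentSpace J (φ x) :=
  LinearMap.mk₂ ℝ (secondFundamentalForm I J φ x)
    (fun v v' w ↦ by
      simp only [secondFundamentalForm, covAlong_add_apply,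
        leviCivita_add_apply (mdifferentiableAt_extend I E w), map_add]
      abel)
    (fun c v w ↦ by
      simp only [secondFundamentalForm, covAlong_smul_apply,
        leviCivita_smul_apply (mdifferentiableAt_extend I E w), map_smul, smul_sub])
    (fun v w w' ↦ map_add (TensorialAt.mkHom _ x (tensorialAt_secondFundamentalForm hφ v)) w w')
    (fun c v w ↦ map_smul (TensorialAt.mkHom _ x (tensorialAt_secondFundamentalForm hφ v)) c w)

theorem contMDiffAt_secondFundamentalForm (hφ : ContMDiffAt I J ∞ φ x)
    {X Y : Π z : M, TangentSpace I z} (hX : ContMDiffAt I I.tangent ∞ (T% X) x)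
    (hY : ContMDiffAt I I.tangent ∞ (T% Y) x) (hφ' : ∀ z, ContMDiffAt I J ∞ φ z) :
    ContMDiffAt I J.tangent ∞
      (fun z ↦ (⟨φ z, secondFundamentalForm I J φ z (X z) (Y z)⟩ : TangentBundle J N)) x := by
  have h1 := contMDiffAt_covAlong (contMDiffAt_mfderiv_apply hφ hY) hX
  have h2 := contMDiffAt_mfderiv_apply hφ (contMDiffAt_leviCivita hX hY)
  have h3 := contMDiffAt_along_add h1 (contMDiffAt_along_smul (contMDiffAt_const (c := (-1 : ℝ))) h2)
  refine contMDiffAt_along_congr ?_ h3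
  filter_upwards [eventually_mdifferentiableAt hY] with z hz
  rw [secondFundamentalForm_apply (hφ' z) hz]
  simp only [Pi.add_apply, Pi.smul_apply']
  rw [neg_one_smul, sub_eq_add_neg]

end SecondFundamentalForm

section Curvature

variable {E : Type*} [NormedAddCommGroup E] [NormedSpace ℝ E] [FiniteDimensional ℝ E]
  {H : Type*} [TopologicalSpace H] {I : ModelWithCorners ℝ E H}
  {M : Type*} [TopologicalSpace M] [ChartedSpace H M] [IsManifold I ∞ M]
  [RiemannianBundle (fun x : M ↦ TangentSpace I x)]
  [IsContMDiffRiemannianBundle I ∞ E (fun x : M ↦ TangentSpace I x)]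
  {x : M}

theorem curvature_eq (u v w : TangentSpace I x) :
    curvature I x u v w =
      leviCivita I (fun y ↦ leviCivita I (extend E w) y (extend E v y)) x u
        - leviCivita I (fun y ↦ leviCivita I (extend E w) y (extend E u y)) x v := by
  simp only [curvature]
  rw [mlieBracket_extend, leviCivita_zero_apply (mdifferentiableAt_extend ..), sub_zero]

theorem curvature_self (u w : TangentSpace I x) : curvature I x u u w = 0 := by
  rw [curvature_eq, sub_self]

theorem mdifferentiableAt_leviCivita_extend (v w : TangentSpace I x) :
    MDiffAt (T% (fun y ↦ leviCivita I (extend E w) y (extend E v y))) x :=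
  (contMDiffAt_leviCivita (contMDiffAt_extend (k := ∞) I E v)
    (contMDiffAt_extend (k := ∞) I E w)).mdifferentiableAt (by simp)

theorem eventually_mdifferentiableAt_extend (w : TangentSpace I x) :
    ∀ᶠ y in 𝓝 x, MDiffAt (T% (extend E w)) y :=
  eventually_mdifferentiableAt (contMDiffAt_extend (k := ∞) I E w)

theorem leviCivita_leviCivita_extend_add_left (u v v' w : TangentSpace I x) :
    leviCivita I (fun y ↦ leviCivita I (extend E w) y (extend E (v + v') y)) x u =
      leviCivita I (fun y ↦ leviCivita I (extend E w) y (extend E v y)) x u +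
      leviCivita I (fun y ↦ leviCivita I (extend E w) y (extend E v' y)) x u := by
  rw [← leviCivita_add (mdifferentiableAt_leviCivita_extend v w)
    (mdifferentiableAt_leviCivita_extend v' w)]
  refine leviCivita_congr ?_ u
  filter_upwards [extend_add_eventuallyEq v v', eventually_mdifferentiableAt_extend w] with y h1 h2
  exact (congrArg (leviCivita I (extend E w) y) h1).trans (leviCivita_add_apply h2 _ _)

theorem leviCivita_leviCivita_extend_smul_left (c : ℝ) (u v w : TangentSpace I x) :
    leviCivita I (fun y ↦ leviCivita I (extend E w) y (extend E (c • v) y)) x u =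
      c • leviCivita I (fun y ↦ leviCivita I (extend E w) y (extend E v y)) x u := by
  have h := leviCivita_smul (f := fun _ : M ↦ c) mdifferentiableAt_const
    (mdifferentiableAt_leviCivita_extend v w) u
  rw [mvfderiv_const, zero_apply, zero_smul, add_zero] at h
  rw [← h]
  refine leviCivita_congr ?_ u
  filter_upwards [extend_smul_eventuallyEq c v, eventually_mdifferentiableAt_extend w] with y h1 h2
  exact (congrArg (leviCivita I (extend E w) y) h1).trans (leviCivita_smul_apply h2 _ _)

theorem leviCivita_leviCivita_extend_add_right (u v w w' : TangentSpace I x) :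
    leviCivita I (fun y ↦ leviCivita I (extend E (w + w')) y (extend E v y)) x u =
      leviCivita I (fun y ↦ leviCivita I (extend E w) y (extend E v y)) x u +
      leviCivita I (fun y ↦ leviCivita I (extend E w') y (extend E v y)) x u := by
  rw [← leviCivita_add (mdifferentiableAt_leviCivita_extend v w)
    (mdifferentiableAt_leviCivita_extend v w')]
  refine leviCivita_congr ?_ u
  filter_upwards [(extend_add_eventuallyEq w w').eventually_nhds,
    eventually_mdifferentiableAt_extend w, eventually_mdifferentiableAt_extend w'] with y h h1 h2
  exact (leviCivita_congr h _).trans (leviCivita_add h1 h2 _)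

theorem leviCivita_leviCivita_extend_smul_right (c : ℝ) (u v w : TangentSpace I x) :
    leviCivita I (fun y ↦ leviCivita I (extend E (c • w)) y (extend E v y)) x u =
      c • leviCivita I (fun y ↦ leviCivita I (extend E w) y (extend E v y)) x u := by
  have h := leviCivita_smul (f := fun _ : M ↦ c) mdifferentiableAt_const
    (mdifferentiableAt_leviCivita_extend v w) u
  rw [mvfderiv_const, zero_apply, zero_smul, add_zero] at h
  rw [← h]
  refine leviCivita_congr ?_ u
  filter_upwards [(extend_smul_eventuallyEq c w).eventually_nhds,
    eventually_mdifferentiableAt_extend w] with y h h1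
  refine (leviCivita_congr h _).trans ?_
  rw [leviCivita_smul mdifferentiableAt_const h1, mvfderiv_const, zero_apply, zero_smul, add_zero]
  rfl

/-- The curvature tensor `R(u, ·) ·` as a bilinear map. -/
noncomputable def curvatureHom (u : TangentSpace I x) :
    TangentSpace I x →ₗ[ℝ] TangentSpace I x →ₗ[ℝ] TangentSpace I x :=
  LinearMap.mk₂ ℝ (curvature I x u)
    (fun v v' w ↦ by
      simp only [curvature_eq, leviCivita_leviCivita_extend_add_left,
        leviCivita_add_apply (mdifferentiableAt_leviCivita_extend u w)]
      abel)
    (fun c v w ↦ by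
      simp only [curvature_eq, leviCivita_leviCivita_extend_smul_left,
        leviCivita_smul_apply (mdifferentiableAt_leviCivita_extend u w), smul_sub])
    (fun v w w' ↦ by
      simp only [curvature_eq, leviCivita_leviCivita_extend_add_right]
      abel)
    (fun c v w ↦ by
      simp only [curvature_eq, leviCivita_leviCivita_extend_smul_right, smul_sub])

end Curvature

/-- The trace of a bilinear map does not depend on the orthonormal basis. -/
theorem sum_bilin_orthonormalBasis {V W ι κ : Type*} [NormedAddCommGroup V]
    [InnerProductSpace ℝ V] [AddCommGroup W] [Module ℝ W] [Fintype ι] [Fintype κ]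
    (B : V →ₗ[ℝ] V →ₗ[ℝ] W) (e : OrthonormalBasis ι ℝ V) (f : OrthonormalBasis κ ℝ V) :
    ∑ i, B (e i) (e i) = ∑ j, B (f j) (f j) := by
  calc ∑ i, B (e i) (e i) = ∑ i, ∑ j, (inner ℝ (f j) (e i) : ℝ) • B (f j) (e i) := by
        refine Finset.sum_congr rfl fun i _ ↦ ?_
        have h := congrArg (fun v ↦ B v (e i)) (f.sum_repr' (e i))
        simpa only [map_sum, map_smul, LinearMap.sum_apply, LinearMap.smul_apply] using h.symm
    _ = ∑ j, ∑ i, (inner ℝ (f j) (e i) : ℝ) • B (f j) (e i) := Finset.sum_comm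
    _ = ∑ j, B (f j) (f j) := by
        refine Finset.sum_congr rfl fun j _ ↦ ?_
        have h := congrArg (B (f j)) (e.sum_repr' (f j))
        simpa only [map_sum, map_smul, real_inner_comm] using h

section Extension

variable {E : Type*} [NormedAddCommGroup E] [NormedSpace ℝ E] [FiniteDimensional ℝ E]
  {H : Type*} [TopologicalSpace H] {I : ModelWithCorners ℝ E H}
  {M : Type*} [TopologicalSpace M] [T2Space M] [ChartedSpace H M] [IsManifold I ∞ M]

/-- Every tangent vector is the value of a smooth vector field. -/
theorem exists_contMDiff_vectorField_eq (x : M) (v : TangentSpace I x) :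
    ∃ X : Π z : M, TangentSpace I z, ContMDiff I I.tangent ∞ (T% X) ∧ X x = v := by
  let f : SmoothBumpFunction I x := Classical.arbitrary _
  let t := trivializationAt E (TangentSpace I : M → Type _) x
  refine ⟨(f : M → ℝ) • extend E v, ?_, ?_⟩
  · refine ContMDiffOn.smul_section_of_tsupport (u := t.baseSet) f.contMDiff.contMDiffOn
      t.open_baseSet ?_ ?_
    · exact f.tsupport_subset_chartAt_source
    · rw [t.contMDiffOn_section_baseSet_iff]
      refine (contMDiffOn_const (c := (t ⟨x, v⟩).2)).congr fun z hz ↦ ?_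
      simp only [extend]
      rw [Trivialization.apply_mk_symm _ hz]
  · simp only [Pi.smul_apply', extend_apply_self, f.eq_one, one_smul]

end Extension

section Immersion

variable {E : Type*} [NormedAddCommGroup E] [NormedSpace ℝ E] [FiniteDimensional ℝ E]
  {H : Type*} [TopologicalSpace H] {I : ModelWithCorners ℝ E H}
  {M : Type*} [TopologicalSpace M] [ChartedSpace H M] [IsManifold I ∞ M]
  [RiemannianBundle (fun x : M ↦ TangentSpace I x)]
  [IsContMDiffRiemannianBundle I ∞ E (fun x : M ↦ TangentSpace I x)]
  {F : Type*} [NormedAddCommGroup F] [NormedSpace ℝ F] [FiniteDimensional ℝ F]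
  {G : Type*} [TopologicalSpace G] {J : ModelWithCorners ℝ F G}
  {N : Type*} [TopologicalSpace N] [ChartedSpace G N] [IsManifold J ∞ N]
  [RiemannianBundle (fun y : N ↦ TangentSpace J y)]
  [IsContMDiffRiemannianBundle J ∞ F (fun y : N ↦ TangentSpace J y)]
  {φ : M → N} {x : M}

theorem mvfderiv_inner_extend (hφ : IsIsometricImmersion I J φ) (u v w : TangentSpace I x) :
    mvfderiv I (fun z ↦ (inner ℝ (extend E v z) (extend E w z) : ℝ)) x u =
      inner ℝ (covAlong I J φ (fun z ↦ mfderiv I J φ z (extend E v z)) x u) (mfderiv I J φ x w)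
      + inner ℝ (mfderiv I J φ x v)
        (covAlong I J φ (fun z ↦ mfderiv I J φ z (extend E w z)) x u) := by
  have h := mvfderiv_inner_along
    (contMDiffAt_mfderiv_apply hφ.contMDiff.contMDiffAt (contMDiffAt_extend (k := ∞) I E v))
    (contMDiffAt_mfderiv_apply hφ.contMDiff.contMDiffAt (contMDiffAt_extend (k := ∞) I E w)) u
  simp only [hφ.inner_mfderiv, extend_apply_self] at h
  exact h

/-- The second fundamental form of an isometric immersion is normal. -/
theorem inner_secondFundamentalForm_mfderiv [I.Boundaryless] (hφ : IsIsometricImmersion I J φ)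
    (u v w : TangentSpace I x) :
    inner ℝ (secondFundamentalForm I J φ x v w) (mfderiv I J φ x u) = 0 := by
  have hk := inner_leviCivita_apply (mdifferentiableAt_extend I E w) v u
  have hs := covAlong_mfderiv_extend_symm (J := J) (φ := φ) (x := x) hφ.contMDiff.contMDiffAt
  simp only [koszul, mlieBracket_extend, inner_zero_left, extend_apply_self,
    mvfderiv_inner_extend hφ] at hk
  simp only [secondFundamentalForm]
  rw [inner_sub_left, hφ.inner_mfderiv, hk, hs w v, hs u v, hs u w,
    real_inner_comm _ (mfderiv I J φ x w)]
  ring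

theorem inner_tensionField_mfderiv [I.Boundaryless] (hφ : IsIsometricImmersion I J φ)
    (u : TangentSpace I x) :
    inner ℝ (tensionField I J φ x) (mfderiv I J φ x u) = 0 := by
  rw [tensionField, sum_inner]
  exact Finset.sum_eq_zero fun i _ ↦ inner_secondFundamentalForm_mfderiv hφ _ _ _

theorem contMDiffAt_tensionField (hφ : ContMDiff I J ∞ φ) (x : M) :
    ContMDiffAt I J.tangent ∞ (fun z ↦ (⟨φ z, tensionField I J φ z⟩ : TangentBundle J N)) x := by
  set t := trivializationAt E (TangentSpace I : M → Type _) x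
  have hx : x ∈ t.baseSet := mem_baseSet_trivializationAt E _ x
  let b := finBasis ℝ E
  let c (k) (z : M) : TangentSpace I z →ₗ[ℝ] ℝ := t.localFrameCoeff I b k z
  let e (z : M) := stdOrthonormalBasis ℝ (TangentSpace I z)
  let W (k) (z : M) : TangentSpace I z := ∑ i, c k z (e z i) • e z i
  have hs (k) : ContMDiffAt I I.tangent ∞ (T% (t.localFrame b k)) x :=
    contMDiffAt_localFrame_of_mem ∞ t b k hx
  have hW (k) : ContMDiffAt I I.tangent ∞ (T% (W k)) x := by
    refine contMDiffAt_of_inner fun Z hZ ↦ ?_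
    refine (contMDiffAt_localFrameCoeff b hx hZ k).congr_of_eventuallyEq
      (Eventually.of_forall fun z ↦ ?_)
    have h := congrArg (c k z) ((e z).sum_repr' (Z z))
    simp only [W, sum_inner, real_inner_smul_left]
    simp only [map_sum, map_smul, smul_eq_mul] at h
    refine Eq.trans (Finset.sum_congr rfl fun i _ ↦ mul_comm _ _) h
  have hB (k) := contMDiffAt_secondFundamentalForm hφ.contMDiffAt (hs k) (hW k)
    fun z ↦ hφ.contMDiffAt
  refine contMDiffAt_along_congr ?_
    (contMDiffAt_along_sum Finset.univ hφ.contMDiffAt fun k _ ↦ hB k)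
  filter_upwards [t.open_baseSet.mem_nhds hx] with z hz
  rw [Finset.sum_apply]
  let B := secondFundamentalFormHom (I := I) (J := J) (hφ.contMDiffAt (x := z))
  have h1 (k) : secondFundamentalForm I J φ z (t.localFrame b k z) (W k z) =
      ∑ i, B (c k z (e z i) • t.localFrame b k z) (e z i) := by
    change B (t.localFrame b k z) (W k z) = _
    simp only [W, map_sum, map_smul, LinearMap.smul_apply]
  simp only [h1]
  rw [Finset.sum_comm, tensionField]
  refine Finset.sum_congr rfl fun i _ ↦ ?_
  rw [← LinearMap.sum_apply, ← map_sum]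
  have h2 := t.eq_sum_localFrameCoeff_smul (I := I) (b := b) hz (s := extend E (e z i))
  rw [extend_apply_self] at h2
  exact congrArg (fun v ↦ B v (e z i)) h2.symm

end Immersion

section Hypersurface

variable {E : Type*} [NormedAddCommGroup E] [NormedSpace ℝ E] [FiniteDimensional ℝ E]
  {H : Type*} [TopologicalSpace H] {I : ModelWithCorners ℝ E H} [I.Boundaryless]
  {M : Type*} [TopologicalSpace M] [ChartedSpace H M] [IsManifold I ∞ M]
  [RiemannianBundle (fun x : M ↦ TangentSpace I x)]
  [IsContMDiffRiemannianBundle I ∞ E (fun x : M ↦ TangentSpace I x)]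
  {F : Type*} [NormedAddCommGroup F] [NormedSpace ℝ F] [FiniteDimensional ℝ F]
  {G : Type*} [TopologicalSpace G] {J : ModelWithCorners ℝ F G}
  {N : Type*} [TopologicalSpace N] [ChartedSpace G N] [IsManifold J ∞ N]
  [RiemannianBundle (fun y : N ↦ TangentSpace J y)]
  [IsContMDiffRiemannianBundle J ∞ F (fun y : N ↦ TangentSpace J y)]
  {φ : M → N}

/-- If the normal component of `∇̄_v τ` vanishes, then `∇̄_v τ` is orthogonal to `τ`. -/
theorem inner_covAlong_tensionField [T2Space M] (hφ : IsIsometricImmersion I J φ)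
    (hpar : IsNormalParallel I J φ (tensionField I J φ)) (x : M) (v : TangentSpace I x) :
    inner ℝ (covAlong I J φ (tensionField I J φ) x v) (tensionField I J φ x) = 0 := by
  obtain ⟨X, hX, rfl⟩ := exists_contMDiff_vectorField_eq x v
  have h := hpar X hX x
  rw [normalCovAlong, Submodule.starProjection_apply_eq_zero_iff] at h
  refine (Submodule.mem_orthogonal' _ _).1 h _ ((Submodule.mem_orthogonal' _ _).2 ?_)
  rintro _ ⟨u, rfl⟩
  exact inner_tensionField_mfderiv hφ u

/-- A section along `φ` that is orthogonal to its covariant derivatives satisfies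
`⟨∇̄² V(v, w), V⟩ = - ⟨∇̄_w V, ∇̄_v V⟩`. -/
theorem inner_hessianAlong {V : Π x : M, TangentSpace J (φ x)}
    {x : M} (hV : ContMDiffAt I J.tangent ∞ (fun z ↦ (⟨φ z, V z⟩ : TangentBundle J N)) x)
    (h : ∀ z v, inner ℝ (covAlong I J φ V z v) (V z) = 0) (v w : TangentSpace I x) :
    inner ℝ (hessianAlong I J φ V x v w) (V x) =
      - inner ℝ (covAlong I J φ V x w) (covAlong I J φ V x v) := by
  have h1 := mvfderiv_inner_along
    (contMDiffAt_covAlong hV (contMDiffAt_extend (k := ∞) I E w)) hV v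
  simp only [h, mvfderiv_const, extend_apply_self, zero_apply] at h1
  simp only [hessianAlong]
  rw [inner_sub_left, h, sub_zero]
  linarith

/-- The orthonormal basis of `T_{φ x} N` adapted to a hypersurface: a unit normal vector
together with the image of an orthonormal basis of `T_x M`. -/
theorem exists_adapted_orthonormalBasis (hφ : IsIsometricImmersion I J φ)
    (hdim : finrank ℝ E + 1 = finrank ℝ F) {x : M} {ν : TangentSpace J (φ x)} (hν : ‖ν‖ = 1)
    (hν' : ∀ u, inner ℝ ν (mfderiv I J φ x u) = 0) {ι : Type*} [Fintype ι]
    (e : OrthonormalBasis ι ℝ (TangentSpace I x)) :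
    ∃ f : OrthonormalBasis (Option ι) ℝ (TangentSpace J (φ x)),
      f none = ν ∧ ∀ i, f (some i) = mfderiv I J φ x (e i) := by
  let f : Option ι → TangentSpace J (φ x) := fun o ↦ o.elim ν fun i ↦ mfderiv I J φ x (e i)
  have hf : Orthonormal ℝ f := by
    classical
    rw [orthonormal_iff_ite]
    rintro (_ | i) (_ | j)
    · simp [f, hν]
    · simpa [f] using hν' (e j)
    · simpa [f, real_inner_comm] using hν' (e i)
    · simpa [f, hφ.inner_mfderiv] using orthonormal_iff_ite.1 e.orthonormal i j
  have hcard : Fintype.card (Option ι) = finrank ℝ (TangentSpace J (φ x)) := by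
    rw [Fintype.card_option, ← finrank_eq_card_basis e.toBasis]
    exact hdim
  have hspan : ⊤ ≤ Submodule.span ℝ (Set.range f) :=
    (hf.linearIndependent.span_eq_top_of_card_eq_finrank' hcard).ge
  exact ⟨OrthonormalBasis.mk hf hspan, by simp [f], fun i ↦ by simp [f]⟩

/-- For a hypersurface, the trace of the curvature over the tangent space of `M` in the direction
of a normal section is the Ricci transform. -/
theorem curvatureAlong_eq_ricciTransform (hφ : IsIsometricImmersion I J φ)
    (hdim : finrank ℝ E + 1 = finrank ℝ F) {V : Π x : M, TangentSpace J (φ x)} {x : M}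
    (hV : V x ≠ 0) (hV' : ∀ u, inner ℝ (V x) (mfderiv I J φ x u) = 0) :
    curvatureAlong I J φ V x = ricciTransform J (φ x) (V x) := by
  obtain ⟨f, hf, hf'⟩ := exists_adapted_orthonormalBasis hφ hdim (x := x) (ν := ‖V x‖⁻¹ • V x)
    (norm_smul_inv_norm (𝕜 := ℝ) hV) (fun u ↦ by rw [real_inner_smul_left, hV', mul_zero])
    (stdOrthonormalBasis ℝ (TangentSpace I x))
  have h := sum_bilin_orthonormalBasis (curvatureHom (V x)) f
    (stdOrthonormalBasis ℝ (TangentSpace J (φ x)))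
  rw [Fintype.sum_option, hf, map_smul, map_smul, LinearMap.smul_apply] at h
  simp only [hf', curvatureHom, LinearMap.mk₂_apply, curvature_self, smul_zero, zero_add] at h
  exact h

/-- A normal-parallel biharmonic hypersurface in a manifold of non-positive Ricci curvature has
parallel tension field. -/
theorem covAlong_tensionField_eq_zero [T2Space M] (hφ : IsIsometricImmersion I J φ)
    (hdim : finrank ℝ E + 1 = finrank ℝ F) (hRic : RicciNonpos J N)
    (hpar : IsNormalParallel I J φ (tensionField I J φ)) {x : M}
    (hbi : bitensionField I J φ x = 0) (hx : tensionField I J φ x ≠ 0)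
    (i : Fin (finrank ℝ (TangentSpace I x))) :
    covAlong I J φ (tensionField I J φ) x (stdOrthonormalBasis ℝ (TangentSpace I x) i) = 0 := by
  have h := congrArg (fun v ↦ (inner ℝ v (tensionField I J φ x) : ℝ)) hbi
  simp only [bitensionField, roughLaplacian] at h
  rw [curvatureAlong_eq_ricciTransform hφ hdim hx (inner_tensionField_mfderiv hφ), inner_sub_left,
    inner_neg_left, sum_inner, inner_zero_left] at h
  simp only [inner_hessianAlong (contMDiffAt_tensionField hφ.contMDiff x)
    (inner_covAlong_tensionField hφ hpar), Finset.sum_neg_distrib, neg_neg] at h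
  have hR := hRic (φ x) (tensionField I J φ x)
  have h0 : ∑ i, (inner ℝ
      (covAlong I J φ (tensionField I J φ) x (stdOrthonormalBasis ℝ (TangentSpace I x) i))
      (covAlong I J φ (tensionField I J φ) x (stdOrthonormalBasis ℝ (TangentSpace I x) i)) : ℝ)
        = 0 :=
    le_antisymm (by linarith) (Finset.sum_nonneg fun i _ ↦ real_inner_self_nonneg)
  exact inner_self_eq_zero.1
    ((Finset.sum_eq_zero_iff_of_nonneg fun i _ ↦ real_inner_self_nonneg).1 h0 i (Finset.mem_univ i))

/-- The Weingarten equation for the tension field. -/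
theorem inner_tensionField_secondFundamentalForm (hφ : IsIsometricImmersion I J φ) {x : M}
    (v w : TangentSpace I x) :
    inner ℝ (tensionField I J φ x) (secondFundamentalForm I J φ x v w) =
      - inner ℝ (covAlong I J φ (tensionField I J φ) x v) (mfderiv I J φ x w) := by
  have h := mvfderiv_inner_along (contMDiffAt_tensionField hφ.contMDiff x)
    (contMDiffAt_mfderiv_apply hφ.contMDiff.contMDiffAt (contMDiffAt_extend (k := ∞) I E w)) v
  simp only [inner_tensionField_mfderiv hφ, mvfderiv_const, extend_apply_self, zero_apply] at h
  simp only [secondFundamentalForm]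
  rw [inner_sub_right, inner_tensionField_mfderiv hφ]
  linarith

end Hypersurface

end RiemGeom

theorem theorem3p7
    {E : Type*} [NormedAddCommGroup E] [NormedSpace ℝ E] [FiniteDimensional ℝ E]
    {H : Type*} [TopologicalSpace H] (I : ModelWithCorners ℝ E H) [I.Boundaryless]
    {M : Type*} [TopologicalSpace M] [T2Space M] [ChartedSpace H M] [IsManifold I ∞ M]
    [RiemannianBundle (fun x : M ↦ TangentSpace I x)]
    [IsContMDiffRiemannianBundle I ∞ E (fun x : M ↦ TangentSpace I x)]
    {F : Type*} [NormedAddCommGroup F] [NormedSpace ℝ F] [FiniteDimensional ℝ F]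
    {G : Type*} [TopologicalSpace G] (J : ModelWithCorners ℝ F G) [J.Boundaryless]
    {N : Type*} [TopologicalSpace N] [T2Space N] [ChartedSpace G N] [IsManifold J ∞ N]
    [RiemannianBundle (fun y : N ↦ TangentSpace J y)]
    [IsContMDiffRiemannianBundle J ∞ F (fun y : N ↦ TangentSpace J y)]
    (hdim : finrank ℝ E + 1 = finrank ℝ F)
    (hRic : RiemGeom.RicciNonpos J N)
    (φ : M → N) (hφ : RiemGeom.IsIsometricImmersion I J φ)
    (hpar : RiemGeom.IsNormalParallel I J φ (RiemGeom.tensionField I J φ))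
    (hbi : RiemGeom.IsBiharmonic I J φ) :
    RiemGeom.IsHarmonic I J φ := by
  refine ⟨hφ.contMDiff, fun x ↦ by_contra fun hx ↦ hx ?_⟩
  rw [← inner_self_eq_zero (𝕜 := ℝ)]
  nth_rw 2 [RiemGeom.tensionField]
  rw [inner_sum]
  refine Finset.sum_eq_zero fun i _ ↦ ?_
  rw [RiemGeom.inner_tensionField_secondFundamentalForm hφ,
    RiemGeom.covAlong_tensionField_eq_zero hφ hdim hRic hpar (hbi.2 x) hx, inner_zero_left,
    neg_zero]
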